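/- Let $\mathbb{K}$ be a field, and let $R$ be a complete local noetherian commutative $\mathbb{K}$-algebra with maximal ideal $\mathfrak{m}$ and residue field $R/\mathfrak{m} = \mathbb{K}$. Put $R_i := R/\mathfrak{m}^{i+1}$ for $i \in \mathbb{N} = \{0, 1, 2, \ldots\}$. Let $X$ be a topological space, $U \subset X$ an open set, and $\mathcal{M}$ a sheaf of $R$-modules on $X$. Conventions. An $R$-module $M$ is called $\mathfrak{m}$-adically complete if the canonical homomorphism $M \to \varprojlim_i (R_i \otimes_R M)$ is bijective. For an $R$-algebra $R'$, the sheaf $R' \otimes_R \mathcal{M}$ is the sheaf associated to the presheaf $V \mapsto R' \otimes_R \Gamma(V, \mathcal{M})$, and $\mathfrak{m}^i \mathcal{M}$ is the sheaf associated to the presheaf $V \mapsto \mathfrak{m}^i\, \Gamma(V, \mathcal{M})$. The sheaf $\mathcal{M}$ is called $\mathfrak{m}$-adically complete if the canonical sheaf homomorphism $\mathcal{M} \to \varprojlim_i (R_i \otimes_R \mathcal{M})$ is an isomorphism (the inverse limit of sheaves being $V \mapsto \varprojlim_i \Gamma(V, R_i \otimes_R \mathcal{M})$), and flat if for every $x \in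 X$ the stalk $\mathcal{M}_x$ is a flat $R$-module. For a sheaf $\mathcal{N}$ of abelian groups on $X$, an open set $V \subset X$ is called $\mathcal{N}$-acyclic if the derived functor sheaf cohomology satisfies $\mathrm{H}^i(V, \mathcal{N}) = 0$ for all $i > 0$; a collection of open sets is called $\mathcal{N}$-acyclic if all intersections of finitely many (at least one) of its members are $\mathcal{N}$-acyclic; and $X$ has enough $\mathcal{N}$-acyclic open sets if every open covering of every open set $V \subset X$ has a refinement that is an $\mathcal{N}$-acyclic open covering of $V$. Define $M := \Gamma(U, \mathcal{M})$ and $\mathcal{M}_0 := \mathbb{K} \otimes_R \mathcal{M}$. Assume that $\mathcal{M}$ is flat over $R$ and $\mathfrak{m}$-adically complete, that $X$ has enough $\mathcal{M}_0$-acyclic open sets, and that $U$ is $\mathcal{M}_0$-acyclic. Then: 1. The $R$-module $M$ is flat and $\mathfrak{m}$-adically complete. 2. For every $i \in \mathbb{N}$: (a) the canonical homomorphism $R_i \otimes_R M \to \Gamma(U, R_i \otimes_R \mathcal{M})$ is bijective; (b) the $R$-module $\mathfrak{m}^i M$ is $\mathfrak{m}$-adically complete; (c) the sheaf of $R$-modules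 $\mathfrak{m}^i \mathcal{M}$ is $\mathfrak{m}$-adically complete; (d) the canonical homomorphism $\mathfrak{m}^i M \to \Gamma(U, \mathfrak{m}^i \mathcal{M})$ is bijective. -/

import Mathlib

open CategoryTheory CategoryTheory.Limits TopologicalSpace Opposite
open scoped TensorProduct

universe u v

noncomputable section

namespace CompleteSheaf

/-- Sheaves of `R`-modules on the topological space `X`. -/
abbrev ModuleSheaf (R : Type u) [CommRing R] (X : TopCat.{u}) :=
  Sheaf (Opens.grothendieckTopology X) (ModuleCat.{u} R)

variable {R : Type u} [CommRing R] {X : TopCat.{u}}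

/-- The functor `M ↦ I M`, where `I M` is the submodule of `M` generated by the products `a m` with
`a ∈ I` and `m ∈ M`. -/
def idealMulFunctor (I : Ideal R) : ModuleCat.{u} R ⥤ ModuleCat.{u} R where
  obj M := ModuleCat.of R (I • ⊤ : Submodule R M)
  map {M N} f := ModuleCat.ofHom (f.hom.restrict (p := I • ⊤) (q := I • ⊤) fun x hx => by
    have h : Submodule.map f.hom (I • ⊤) ≤ I • ⊤ := by
      rw [Submodule.map_smul'']
      exact Submodule.smul_mono le_rfl le_top
    exact h (Submodule.mem_map_of_mem hx))

/-- The presheaf `V ↦ I Γ(V, 𝓜)`. -/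
abbrev idealMulPresheaf (I : Ideal R)
    (M : ModuleSheaf R X) :
    (Opens X)ᵒᵖ ⥤ ModuleCat.{u} R :=
  M.obj ⋙ idealMulFunctor I

/-- The sheaf `I 𝓜`, associated to the presheaf `V ↦ I Γ(V, 𝓜)`. -/
abbrev idealMul (I : Ideal R) (M : ModuleSheaf R X) :
    ModuleSheaf R X :=
  (presheafToSheaf _ _).obj (idealMulPresheaf I M)

/-- The canonical homomorphism `I Γ(U, 𝓜) → Γ(U, I 𝓜)`. -/
def idealMulSections (I : Ideal R) (M : ModuleSheaf R X)
    (U : Opens X) :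
    (I • ⊤ : Submodule R (M.obj.obj (op U))) →ₗ[R] (idealMul I M).obj.obj (op U) :=
  ((toSheafify (Opens.grothendieckTopology X) (idealMulPresheaf I M)).app (op U)).hom

/-- The functor `M ↦ P ⊗ M`. -/
def tensorFunctor (P : Type u) [AddCommGroup P] [Module R P] :
    ModuleCat.{u} R ⥤ ModuleCat.{u} R where
  obj M := ModuleCat.of R (P ⊗[R] M)
  map f := ModuleCat.ofHom (f.hom.lTensor P)
  map_id M := by
    ext : 1
    exact LinearMap.lTensor_id P M
  map_comp f g := by
    ext : 1
    exact LinearMap.lTensor_comp P g.hom f.hom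

/-- The presheaf `V ↦ P ⊗ Γ(V, 𝓜)`. -/
abbrev tensorPresheaf (P : Type u) [AddCommGroup P] [Module R P]
    (M : ModuleSheaf R X) :
    (Opens X)ᵒᵖ ⥤ ModuleCat.{u} R :=
  M.obj ⋙ tensorFunctor P

/-- The sheaf `P ⊗ 𝓜`, associated to the presheaf `V ↦ P ⊗ Γ(V, 𝓜)`. -/
abbrev tensor (P : Type u) [AddCommGroup P] [Module R P]
    (M : ModuleSheaf R X) :
    ModuleSheaf R X :=
  (presheafToSheaf _ _).obj (tensorPresheaf P M)

/-- The canonical homomorphism `P ⊗ Γ(U, 𝓜) → Γ(U, P ⊗ 𝓜)`. -/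
def tensorSections (P : Type u) [AddCommGroup P] [Module R P]
    (M : ModuleSheaf R X) (U : Opens X) :
    P ⊗[R] (M.obj.obj (op U)) →ₗ[R] (tensor P M).obj.obj (op U) :=
  ((toSheafify (Opens.grothendieckTopology X) (tensorPresheaf P M)).app (op U)).hom

/-- The presheaf homomorphism `P ⊗ Γ(V, 𝓜) → Q ⊗ Γ(V, 𝓜)` induced by `f : P → Q`. -/
def tensorPresheafMap {P Q : Type u} [AddCommGroup P] [Module R P] [AddCommGroup Q] [Module R Q]
    (f : P →ₗ[R] Q) (M : ModuleSheaf R X) :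
    tensorPresheaf P M ⟶ tensorPresheaf Q M where
  app V := ModuleCat.ofHom (f.rTensor (M.obj.obj V))
  naturality V W g := by
    ext : 1
    exact (LinearMap.rTensor_comp_lTensor (f := f) (g := (M.obj.map g).hom)).trans
      (LinearMap.lTensor_comp_rTensor (f := f) (g := (M.obj.map g).hom)).symm

/-- The presheaf homomorphism `Γ(V, 𝓜) → A ⊗ Γ(V, 𝓜)`, `s ↦ 1 ⊗ s`, for an `R`-algebra `A`. -/
def toTensorPresheaf (A : Type u) [CommRing A] [Algebra R A]
    (M : ModuleSheaf R X) :
    M.obj ⟶ tensorPresheaf A M where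
  app V := ModuleCat.ofHom (TensorProduct.mk R A (M.obj.obj V) 1)

/-- The canonical sheaf homomorphism `𝓜 → A ⊗ 𝓜`. -/
def toTensor (A : Type u) [CommRing A] [Algebra R A]
    (M : ModuleSheaf R X) :
    M ⟶ tensor A M :=
  ⟨toTensorPresheaf A M ≫ toSheafify (Opens.grothendieckTopology X) (tensorPresheaf A M)⟩

/-- The canonical projection `R / I ^ (j + 1) → R / I ^ (i + 1)` for `i ≤ j`. -/
def powTransition (I : Ideal R) {i j : ℕ} (h : i ≤ j) :
    (R ⧸ I ^ (j + 1)) →ₗ[R] (R ⧸ I ^ (i + 1)) :=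
  (Ideal.Quotient.factorₐ R (Ideal.pow_le_pow_right (Nat.succ_le_succ h))).toLinearMap

lemma tensorPresheafMap_id (P : Type u) [AddCommGroup P] [Module R P] (M : ModuleSheaf R X) :
    tensorPresheafMap (LinearMap.id : P →ₗ[R] P) M = 𝟙 (tensorPresheaf P M) := by
  ext V : 3
  exact LinearMap.rTensor_id _ _

lemma tensorPresheafMap_comp {P Q S : Type u} [AddCommGroup P] [Module R P] [AddCommGroup Q]
    [Module R Q] [AddCommGroup S] [Module R S] (f : P →ₗ[R] Q) (g : Q →ₗ[R] S)
    (M : ModuleSheaf R X) :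
    tensorPresheafMap (g ∘ₗ f) M = tensorPresheafMap f M ≫ tensorPresheafMap g M := by
  ext V : 3
  exact LinearMap.rTensor_comp _ g f

lemma powTransition_refl (I : Ideal R) (i : ℕ) : powTransition I (le_refl i) = LinearMap.id := by
  ext
  rfl

lemma powTransition_comp (I : Ideal R) {i j k : ℕ} (h : i ≤ j) (h' : j ≤ k) :
    powTransition I (h.trans h') = powTransition I h ∘ₗ powTransition I h' := by
  ext
  rfl

lemma toTensorPresheaf_comp (I : Ideal R) {i j : ℕ} (h : i ≤ j) (M : ModuleSheaf R X) :
    toTensorPresheaf (R ⧸ I ^ (j + 1)) M ≫ tensorPresheafMap (powTransition I h) M =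
      toTensorPresheaf (R ⧸ I ^ (i + 1)) M := by
  ext V : 3
  rfl

/-- The inverse system of sheaves `i ↦ R_i ⊗ 𝓜`, where `R_i = R / I ^ (i + 1)`. -/
def adicSystem (I : Ideal R) (M : ModuleSheaf R X) : ℕᵒᵖ ⥤ ModuleSheaf R X where
  obj i := tensor (R ⧸ I ^ (i.unop + 1)) M
  map f := (presheafToSheaf _ _).map (tensorPresheafMap (powTransition I (leOfHom f.unop)) M)
  map_id i := by
    have h := powTransition_refl I i.unop
    rw [h, tensorPresheafMap_id]
    exact (presheafToSheaf _ _).map_id _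
  map_comp f g := by
    rw [← Functor.map_comp, ← tensorPresheafMap_comp, ← powTransition_comp]

/-- The canonical homomorphisms `𝓜 → R_i ⊗ 𝓜`, as a cone over the inverse system. -/
def adicCone (I : Ideal R) (M : ModuleSheaf R X) : Cone (adicSystem I M) where
  pt := M
  π :=
    { app := fun i => toTensor (R ⧸ I ^ (i.unop + 1)) M
      naturality := fun i j f => by
        apply Sheaf.hom_ext
        change 𝟙 _ ≫ toTensorPresheaf _ M ≫ toSheafify _ _ =
          (toTensorPresheaf _ M ≫ toSheafify _ _) ≫ sheafifyMap _ (tensorPresheafMap _ M)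
        rw [Category.id_comp, Category.assoc, ← toSheafify_naturality, ← Category.assoc,
          toTensorPresheaf_comp] }

/-- The `I`-adic completion `lim_i (R_i ⊗ 𝓜)`, a limit in the category of sheaves of `R`-modules
(equivalently, the sheaf `V ↦ lim_i Γ(V, R_i ⊗ 𝓜)`). -/
def adicCompletion (I : Ideal R) (M : ModuleSheaf R X) :
    ModuleSheaf R X :=
  limit (adicSystem I M)

/-- The canonical sheaf homomorphism from `𝓜` to its `I`-adic completion. -/
def toAdicCompletion (I : Ideal R)
    (M : ModuleSheaf R X) :
    M ⟶ adicCompletion I M :=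
  limit.lift (adicSystem I M) (adicCone I M)

/-- The sheaf `𝓜` is `I`-adically complete: the canonical homomorphism from `𝓜` to its `I`-adic
completion is an isomorphism. -/
def IsSheafAdicComplete (I : Ideal R)
    (M : ModuleSheaf R X) : Prop :=
  IsIso (toAdicCompletion I M)

/-- The sheaf `𝓜` is flat over `R`: all its stalks are flat `R`-modules. -/
def IsSheafFlat (M : ModuleSheaf R X) : Prop :=
  ∀ x : X, Module.Flat R (TopCat.Presheaf.stalk (C := ModuleCat.{u} R) M.obj x)

/-- The underlying sheaf of abelian groups of a sheaf of `R`-modules. -/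
abbrev toAb (M : ModuleSheaf R X) :
    Sheaf (Opens.grothendieckTopology X) AddCommGrpCat.{u} :=
  (sheafCompose _ (forget₂ (ModuleCat.{u} R) AddCommGrpCat.{u})).obj M

/-- The open set `U` is `𝓝`-acyclic: `Hⁱ(U, 𝓝) = 0` for all `i > 0`. -/
def IsAcyclic (N : Sheaf (Opens.grothendieckTopology X) AddCommGrpCat.{u}) (U : Opens X) : Prop :=
  ∀ i : ℕ, 0 < i → Subsingleton (Sheaf.H'.{u} N i U)

/-- A collection of open sets is `𝓝`-acyclic if all the intersections of finitely many (at least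
one) of its members are `𝓝`-acyclic. -/
def IsAcyclicCollection (N : Sheaf (Opens.grothendieckTopology X) AddCommGrpCat.{u})
    {κ : Type u} (V : κ → Opens X) : Prop :=
  ∀ (F : Finset κ) (hF : F.Nonempty), IsAcyclic N (F.inf' hF V)

/-- There are enough `𝓝`-acyclic open sets: every open covering of every open set `U` has a
refinement that is an `𝓝`-acyclic open covering of `U`. -/
def HasEnoughAcyclicOpens (N : Sheaf (Opens.grothendieckTopology X) AddCommGrpCat.{u}) : Prop :=
  ∀ (U : Opens X) (ι : Type u) (W : ι → Opens X), ⨆ k, W k = U →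
    ∃ (κ : Type u) (V : κ → Opens X), ⨆ k, V k = U ∧ IsAcyclicCollection N V ∧
      ∀ k, ∃ l, V k ≤ W l

end CompleteSheaf

end

noncomputable section

namespace CompleteSheaf

/-! ### Degree-wise cohomology of abelian sheaves as Ext from free sheaves. -/

section Cohomology
variable {C : Type u} [SmallCategory C] {J : GrothendieckTopology C}

open Abelian

/-! Write `m` for the maximal ideal and `Γ` for `Γ(U, 𝓜)`. The argument compares `P ⊗ Γ` with `Γ(U,
P ⊗ 𝓜)` for all modules `P` of finite length, by induction on composition series; in a local ring
every simple factor is the residue field.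

Flatness of the stalks makes `P ↦ P ⊗ 𝓜` exact, so `H¹(U, P ⊗ 𝓜) = 0` for all such `P` once this
holds for the residue field (`TensorAcyclic.of_isFiniteLength`). Taking for `P` the kernel of
`R_{i+1} → R_i` shows that the sections of `R_i ⊗ 𝓜` over `U` form a system with surjective
transition maps. Its limit is `Γ` because `𝓜` is complete, so `Γ` maps onto the sections of `R/m ⊗
𝓜`, and then `P ⊗ Γ → Γ(U, P ⊗ 𝓜)` is surjective for all `P` of finite length
(`tensorSections_surjective`).

Let `F n` be the kernel of `Γ → Γ(U, R/m^n ⊗ 𝓜)`. The module `Γ` is complete for this filtration,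
and surjectivity for `P = m^n/m^(n+1)` gives `F n ≤ m^n Γ + F (n+1)`. Summing the resulting series
yields `F n = m^n Γ` (`sectionsFiltration_eq`). Hence `Γ` is `m`-adically complete; the case `n = 1`
gives injectivity for `P = R/m`, thus bijectivity for every `P` of finite length; and since `m^i 𝓜`
is the kernel of `𝓜 → R/m^i ⊗ 𝓜`, its sections are `m^i Γ`.

For flatness, `m^k/m^(k+1) ⊗ Γ → R/m^(k+1) ⊗ Γ` is injective because its sheaf analogue is. A lift
of a basis of `Γ/mΓ` then expresses each element of `Γ` uniquely as a convergent series with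
coefficients tending to zero, and the equational criterion follows with Artin–Rees
(`flat_of_expansion`).

Completeness of `m^i 𝓜` rests on an embedding of `R/m^(j+1) ⊗ m^i 𝓜` in `R/m^(i+j+1) ⊗ 𝓜`, and needs
neither flatness nor cohomology (`idealMul_isSheafAdicComplete`). -/

lemma functor_exact_of_evaluation {C : Type*} [Category C] {A : Type*} [Category A] [Abelian A]
    (S : ShortComplex (C ⥤ A))
    (h : ∀ U, (S.map ((evaluation C A).obj U)).Exact) : S.Exact := by
  rw [ShortComplex.exact_iff_isZero_homology]
  refine Functor.isZero _ fun U => ?_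
  have := h U
  rw [ShortComplex.exact_iff_isZero_homology] at this
  exact this.of_iso (S.mapHomologyIso ((evaluation C A).obj U)).symm

/-- The free abelian sheaf generated by the presheaf represented by `U`. -/
abbrev freeSheaf (J : GrothendieckTopology C) (U : C) : Sheaf J AddCommGrpCat.{u} :=
  (presheafToSheaf J AddCommGrpCat.{u}).obj (yoneda.obj U ⋙ AddCommGrpCat.free)

/-- The canonical section of the free abelian sheaf on `U`. -/
def freeSheafGen (J : GrothendieckTopology C) (U : C) : (freeSheaf J U).obj.obj (op U) :=
  (toSheafify J (yoneda.obj U ⋙ AddCommGrpCat.free)).app (op U)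
    (FreeAbelianGroup.of (𝟙 U))

/-- Yoneda, the free–forgetful adjunction and sheafification: sections over `U` are morphisms out of
the free sheaf on `U`, the object whose Ext groups define `Sheaf.H'`. -/
lemma exists_freeSheaf_hom (F : Sheaf J AddCommGrpCat.{u}) (U : C) (s : F.obj.obj (op U)) :
    ∃ φ : freeSheaf J U ⟶ F, φ.hom.app (op U) (freeSheafGen J U) = s := by
  let α : yoneda.obj U ⋙ AddCommGrpCat.free ⟶ F.obj :=
    { app := fun V => AddCommGrpCat.ofHom
        (FreeAbelianGroup.lift (fun f : (yoneda.obj U).obj V => F.obj.map f.op s))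
      naturality := fun V W g => by
        apply AddCommGrpCat.hom_ext
        refine FreeAbelianGroup.lift_ext _ _ fun x => ?_
        change FreeAbelianGroup.lift (fun f : (yoneda.obj U).obj W => F.obj.map f.op s)
          (FreeAbelianGroup.map (fun f => g.unop ≫ f) (FreeAbelianGroup.of x)) =
          F.obj.map g (FreeAbelianGroup.lift (fun f : (yoneda.obj U).obj V => F.obj.map f.op s)
            (FreeAbelianGroup.of x))
        rw [FreeAbelianGroup.map_of_apply, FreeAbelianGroup.lift_apply_of,
          FreeAbelianGroup.lift_apply_of, op_comp, F.obj.map_comp]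
        rfl }
  refine ⟨⟨sheafifyLift J α F.property⟩, ?_⟩
  have := congr_arg (fun β => β.app (op U) (FreeAbelianGroup.of (𝟙 U)))
    (toSheafify_sheafifyLift J α F.property)
  refine Eq.trans this ?_
  change FreeAbelianGroup.lift _ (FreeAbelianGroup.of _) = s
  simp

/-- A section of `S.X₃` is a morphism from the free sheaf, and the obstruction to lifting it lies in
`Ext¹`, which is the vanishing `H¹(U, S.X₁)`. -/
lemma surjective_of_subsingleton_H' {S : ShortComplex (Sheaf J AddCommGrpCat.{u})}
    (hS : S.ShortExact) (U : C) (h : Subsingleton (Sheaf.H'.{u} S.X₁ 1 U)) :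
    Function.Surjective (S.g.hom.app (op U)) := by
  intro s
  obtain ⟨φ, hφ⟩ := exists_freeSheaf_hom S.X₃ U s
  have h' : Subsingleton (Ext (freeSheaf J U) S.X₁ 1) := h
  obtain ⟨x₂, hx₂⟩ := Ext.covariant_sequence_exact₃ (freeSheaf J U) hS (Ext.mk₀ φ) (zero_add 1)
    (Subsingleton.elim _ _)
  obtain ⟨ψ, rfl⟩ := (Ext.mk₀_bijective _ _).surjective x₂
  rw [Ext.mk₀_comp_mk₀] at hx₂
  have := (Ext.mk₀_bijective _ _).injective hx₂
  refine ⟨ψ.hom.app (op U) (freeSheafGen J U), ?_⟩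
  rw [← hφ, ← this]
  rfl

lemma subsingleton_H'_of_shortExact {S : ShortComplex (Sheaf J AddCommGrpCat.{u})}
    (hS : S.ShortExact) (U : C) (n : ℕ) (h₁ : Subsingleton (Sheaf.H'.{u} S.X₁ n U))
    (h₃ : Subsingleton (Sheaf.H'.{u} S.X₃ n U)) : Subsingleton (Sheaf.H'.{u} S.X₂ n U) := by
  have h₁' : Subsingleton (Ext (freeSheaf J U) S.X₁ n) := h₁
  have h₃' : Subsingleton (Ext (freeSheaf J U) S.X₃ n) := h₃
  change Subsingleton (Ext (freeSheaf J U) S.X₂ n)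
  refine subsingleton_of_forall_eq 0 fun x => ?_
  obtain ⟨y, rfl⟩ := Ext.covariant_sequence_exact₂ (freeSheaf J U) hS x (Subsingleton.elim _ _)
  rw [Subsingleton.elim y 0, Ext.zero_comp]

lemma subsingleton_H'_of_iso {F G : Sheaf J AddCommGrpCat.{u}} (e : F ≅ G) (U : C) (n : ℕ)
    (h : Subsingleton (Sheaf.H'.{u} F n U)) : Subsingleton (Sheaf.H'.{u} G n U) := by
  exact ((((Sheaf.cohomologyPresheafFunctor.{u} J n).mapIso e).app
    (op U)).addCommGroupIsoToAddEquiv).symm.toEquiv.subsingleton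

lemma subsingleton_H'_of_subsingleton {F : Sheaf J AddCommGrpCat.{u}}
    (h : ∀ U, Subsingleton (F.obj.obj U)) (U : C) (n : ℕ) : Subsingleton (Sheaf.H'.{u} F n U) := by
  have hz : IsZero F := by
    rw [IsZero.iff_id_eq_zero]
    apply Sheaf.hom_ext
    ext V x
    exact (h V).elim _ _
  exact AddCommGrpCat.subsingleton_of_isZero (((extFunctorObj (freeSheaf J U) n)).map_isZero hz)

/-- Exactness in the middle is checked on presheaves, transported by the exact sheafification
functor, and brought back along the counit. -/
lemma shortExact_of_sections (S : ShortComplex (Sheaf J AddCommGrpCat.{u}))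
    (hf : ∀ U, Function.Injective (S.f.hom.app U))
    (hfg : ∀ U, Function.Exact (S.f.hom.app U) (S.g.hom.app U))
    (hg : Presheaf.IsLocallySurjective J S.g.hom) : S.ShortExact := by
  have : Sheaf.IsLocallySurjective S.g := hg
  have h1 : Mono S.f := Sheaf.mono_of_injective _ hf
  have h2 : Epi S.g := inferInstance
  refine ⟨?_⟩
  have h3 : (S.map (sheafToPresheaf J AddCommGrpCat.{u})).Exact := by
    refine functor_exact_of_evaluation _ fun U => ?_
    rw [ShortComplex.ab_exact_iff_function_exact]
    exact hfg U
  have h4 := h3.map (presheafToSheaf J AddCommGrpCat.{u})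
  refine (ShortComplex.exact_iff_of_iso ?_).1 h4
  exact ShortComplex.isoMk ((asIso (sheafificationAdjunction J AddCommGrpCat.{u}).counit).app _)
    ((asIso (sheafificationAdjunction J AddCommGrpCat.{u}).counit).app _)
    ((asIso (sheafificationAdjunction J AddCommGrpCat.{u}).counit).app _)
    ((sheafificationAdjunction J AddCommGrpCat.{u}).counit.naturality S.f).symm
    ((sheafificationAdjunction J AddCommGrpCat.{u}).counit.naturality S.g).symm
end Cohomology

/-! ### Exactness of `P ↦ P ⊗ 𝓜` and dévissage for `H¹`. -/

section Tensor
variable {R : Type u} [CommRing R] {X : TopCat.{u}}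

/-- The sheaf homomorphism `P ⊗ 𝓜 → Q ⊗ 𝓜` induced by `f : P → Q`. -/
abbrev tensorMap {P Q : Type u} [AddCommGroup P] [Module R P] [AddCommGroup Q] [Module R Q]
    (f : P →ₗ[R] Q) (M : ModuleSheaf R X) : tensor P M ⟶ tensor Q M :=
  (presheafToSheaf _ _).map (tensorPresheafMap f M)

/-- An element of `P ⊗ Γ(V, 𝓕)` whose image in `P ⊗ 𝓕_x` is zero vanishes near `x`. -/
lemma exists_restrict_eq_zero (P : Type u) [AddCommGroup P] [Module R P]
    (F : TopCat.Presheaf (ModuleCat.{u} R) X) (V : Opens X)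
   (x : X) (hx : x ∈ V) (t : P ⊗[R] (F.obj (op V))) (ht : (F.germ V x hx).hom.lTensor P t = 0) :
   ∃ (W : Opens X) (i : W ⟶ V), x ∈ W ∧ (F.map i.op).hom.lTensor P t = 0 := by
  -- Tensoring with `P` preserves the filtered colimit that defines the stalk.
  have hc := isColimitOfPreserves (MonoidalCategory.tensorLeft (ModuleCat.of R P))
    (colimit.isColimit ((OpenNhds.inclusion x).op ⋙ F))
  have h : (F.germ V x hx).hom.lTensor P t = (F.germ V x hx).hom.lTensor P 0 := by rw [ht, map_zero]
  obtain ⟨W, i, hW⟩ := (IsColimit.eq_iff' hc (i := op ⟨V, hx⟩) t 0).1 h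
  refine ⟨W.unop.1, homOfLE (leOfHom i.unop), W.unop.2, ?_⟩
  refine Eq.trans hW (map_zero _)

lemma isLocallyInjective_of_locally_eq_zero {F G : (Opens X)ᵒᵖ ⥤ ModuleCat.{u} R} (φ : F ⟶ G)
    (h : ∀ (V : Opens X) (s : F.obj (op V)), φ.app (op V) s = 0 →
      ∀ x ∈ V, ∃ (W : Opens X) (i : W ⟶ V), x ∈ W ∧ F.map i.op s = 0) :
    Presheaf.IsLocallyInjective (Opens.grothendieckTopology X) φ where
  equalizerSieve_mem {V} s t hst x hx := by
    obtain ⟨W, i, hxW, hW⟩ := h V.unop (s - t) ((map_sub _ _ _).trans (sub_eq_zero.2 hst)) x hx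
    exact ⟨W, i, sub_eq_zero.1 ((map_sub _ _ _).symm.trans hW), hxW⟩

/-- Local injectivity on presheaves suffices. A section killed by `f` has zero germs, since
tensoring with the flat stalks keeps `f` injective, and a section with zero germ at a point vanishes
nearby. -/
lemma tensorMap_injective {P Q : Type u} [AddCommGroup P] [Module R P] [AddCommGroup Q] [Module R Q]
    (f : P →ₗ[R] Q) (hf : Function.Injective f) (M : ModuleSheaf R X) (hM : IsSheafFlat M)
      (V : (Opens X)ᵒᵖ) :
    Function.Injective ((tensorMap f M).hom.app V) := by
  revert V
  rw [← Sheaf.isLocallyInjective_iff_injective,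
    Presheaf.isLocallyInjective_presheafToSheaf_map_iff]
  refine isLocallyInjective_of_locally_eq_zero _ fun V (t : P ⊗[R] M.obj.obj (op V)) ht x hx => ?_
  refine exists_restrict_eq_zero P M.obj V x hx t ?_
  have := hM x
  apply Module.Flat.rTensor_preserves_injective_linearMap
    (M := TopCat.Presheaf.stalk (C := ModuleCat.{u} R) M.obj x) f hf
  have ht' : f.rTensor _ t = 0 := ht
  rw [map_zero]
  refine Eq.trans ?_ ((congr_arg
    ((TopCat.Presheaf.germ M.obj V x hx).hom.lTensor Q) ht').trans (map_zero _))
  exact LinearMap.congr_fun ((LinearMap.rTensor_comp_lTensor ..).trans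
    (LinearMap.lTensor_comp_rTensor ..).symm) t

lemma tensorMap_tensorSections {P Q : Type u} [AddCommGroup P] [Module R P] [AddCommGroup Q]
    [Module R Q]
    (f : P →ₗ[R] Q) (M : ModuleSheaf R X) (V : Opens X) (t : P ⊗[R] (M.obj.obj (op V))) :
  (tensorMap f M).hom.app (op V) (tensorSections P M V t) = tensorSections Q M V (f.rTensor _ t) :=
    by
  have := congr_arg (fun β => β.app (op V) t)
    (toSheafify_naturality (Opens.grothendieckTopology X) (tensorPresheafMap f M))
  exact this.symm

/-- The presheaf sequence is right exact and sheafification preserves exactness in the middle. As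
the first map is mono by flatness, the left exact functor of sections over `V` preserves it too. -/
lemma tensorMap_exact {P Q S : Type u} [AddCommGroup P] [Module R P] [AddCommGroup Q] [Module R Q]
    [AddCommGroup S]
    [Module R S]
    (f : P →ₗ[R] Q) (g : Q →ₗ[R] S) (hf : Function.Injective f) (hfg : Function.Exact f g)
      (hg : Function.Surjective g)
    (M : ModuleSheaf R X) (hM : IsSheafFlat M) (V : (Opens X)ᵒᵖ) :
    Function.Exact ((tensorMap f M).hom.app V) ((tensorMap g M).hom.app V) := by
  have w : tensorPresheafMap f M ≫ tensorPresheafMap g M = 0 := by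
    ext V : 3
    exact (LinearMap.rTensor_comp _ _ _).symm.trans
      ((congr_arg _ hfg.linearMap_comp_eq_zero).trans (LinearMap.rTensor_zero _))
  let S₀ : ShortComplex ((Opens X)ᵒᵖ ⥤ ModuleCat.{u} R) := ShortComplex.mk (tensorPresheafMap f M)
    (tensorPresheafMap g M) w
  have hS₀ : S₀.Exact := by
    refine functor_exact_of_evaluation _ fun U => ?_
    rw [ShortComplex.ShortExact.moduleCat_exact_iff_function_exact]
    exact rTensor_exact _ hfg hg
  have hS := hS₀.map (presheafToSheaf (Opens.grothendieckTopology X) (ModuleCat.{u} R))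
  have : Mono (S₀.map (presheafToSheaf (Opens.grothendieckTopology X) (ModuleCat.{u} R))).f :=
    Sheaf.mono_of_injective _ (tensorMap_injective f hf M hM)
  have h := hS.map_of_mono_of_preservesKernel
    (sheafToPresheaf _ _ ⋙ (evaluation _ _).obj V) this inferInstance
  rwa [ShortComplex.ShortExact.moduleCat_exact_iff_function_exact] at h

lemma tensorMap_isLocallySurjective {P Q : Type u} [AddCommGroup P] [Module R P] [AddCommGroup Q]
    [Module R Q]
    (f : P →ₗ[R] Q) (hf : Function.Surjective f) (M : ModuleSheaf R X) : Sheaf.IsLocallySurjective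
      (tensorMap f M) := by
  rw [Presheaf.isLocallySurjective_presheafToSheaf_map_iff]
  exact Presheaf.isLocallySurjective_of_surjective _ _ fun V => LinearMap.rTensor_surjective _ hf

lemma tensorMap_comp {P Q S : Type u} [AddCommGroup P] [Module R P] [AddCommGroup Q] [Module R Q]
    [AddCommGroup S]
    [Module R S] (f : P →ₗ[R] Q) (g : Q →ₗ[R] S) (M : ModuleSheaf R X) :
    tensorMap (g ∘ₗ f) M = tensorMap f M ≫ tensorMap g M := by
  rw [tensorMap, tensorPresheafMap_comp]
  exact (presheafToSheaf _ _).map_comp _ _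

lemma tensorMap_zero (P Q : Type u) [AddCommGroup P] [Module R P] [AddCommGroup Q] [Module R Q]
    (M : ModuleSheaf R X) : tensorMap (0 : P →ₗ[R] Q) M = 0 := by
  have h : tensorPresheafMap (0 : P →ₗ[R] Q) M = 0 := by
    ext V : 3
    exact LinearMap.rTensor_zero _
  rw [tensorMap, h]
  exact (presheafToSheaf _ _).map_zero _ _

lemma tensorMap_id (P : Type u) [AddCommGroup P] [Module R P] (M : ModuleSheaf R X) :
    tensorMap (LinearMap.id : P →ₗ[R] P) M = 𝟙 _ := by
  rw [tensorMap, tensorPresheafMap_id]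
  exact (presheafToSheaf _ _).map_id _

/-- The isomorphism `P ⊗ 𝓜 ≅ Q ⊗ 𝓜` induced by a linear equivalence. -/
def tensorIso {P Q : Type u} [AddCommGroup P] [Module R P] [AddCommGroup Q] [Module R Q]
    (e : P ≃ₗ[R] Q) (M : ModuleSheaf R X) : tensor P M ≅ tensor Q M where
  hom := tensorMap e.toLinearMap M
  inv := tensorMap e.symm.toLinearMap M
  hom_inv_id := by rw [← tensorMap_comp, e.symm_comp, tensorMap_id]
  inv_hom_id := by rw [← tensorMap_comp, e.comp_symm, tensorMap_id]

/-- The short complex of abelian sheaves `P ⊗ 𝓜 → Q ⊗ 𝓜 → S ⊗ 𝓜`. -/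
def tensorShortComplex {P Q S : Type u} [AddCommGroup P] [Module R P] [AddCommGroup Q] [Module R Q]
    [AddCommGroup S] [Module R S] (f : P →ₗ[R] Q) (g : Q →ₗ[R] S)
    (hfg : g ∘ₗ f = 0) (M : ModuleSheaf R X) :
    ShortComplex (Sheaf (Opens.grothendieckTopology X) AddCommGrpCat.{u}) :=
  ShortComplex.mk
    ((sheafCompose _ (forget₂ (ModuleCat.{u} R) AddCommGrpCat.{u})).map (tensorMap f M))
    ((sheafCompose _ (forget₂ (ModuleCat.{u} R) AddCommGrpCat.{u})).map (tensorMap g M)) (by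
      rw [← Functor.map_comp, ← tensorMap_comp, hfg, tensorMap_zero]
      rfl)

lemma tensorShortComplex_shortExact {P Q S : Type u} [AddCommGroup P] [Module R P]
    [AddCommGroup Q] [Module R Q]
    [AddCommGroup S] [Module R S] (f : P →ₗ[R] Q) (g : Q →ₗ[R] S) (hf : Function.Injective f)
      (hfg : Function.Exact f g) (hg : Function.Surjective g) (M : ModuleSheaf R X)
        (hM : IsSheafFlat M) :
    (tensorShortComplex f g hfg.linearMap_comp_eq_zero M).ShortExact :=
  shortExact_of_sections _ (tensorMap_injective f hf M hM) (tensorMap_exact f g hf hfg hg M hM)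
    ⟨(tensorMap_isLocallySurjective g hg M).imageSieve_mem⟩

/-- The first cohomology of `P ⊗ 𝓜` on `U` vanishes. -/
abbrev TensorAcyclic (P : Type u) [AddCommGroup P] [Module R P] (M : ModuleSheaf R X)
    (U : Opens X) : Prop :=
  Subsingleton (Sheaf.H'.{u} (toAb (tensor P M)) 1 U)

lemma tensorMap_surjective {P Q S : Type u} [AddCommGroup P] [Module R P] [AddCommGroup Q]
    [Module R Q]
    [AddCommGroup S] [Module R S] (f : P →ₗ[R] Q) (g : Q →ₗ[R] S) (hf : Function.Injective f)
      (hfg : Function.Exact f g) (hg : Function.Surjective g) (M : ModuleSheaf R X)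
        (hM : IsSheafFlat M) (U : Opens X) (h : TensorAcyclic P M U) :
    Function.Surjective ((tensorMap g M).hom.app (op U)) :=
  surjective_of_subsingleton_H' (tensorShortComplex_shortExact f g hf hfg hg M hM) U h

lemma TensorAcyclic.of_exact {P Q S : Type u} [AddCommGroup P] [Module R P] [AddCommGroup Q]
    [Module R Q]
    [AddCommGroup S] [Module R S] (f : P →ₗ[R] Q) (g : Q →ₗ[R] S) (hf : Function.Injective f)
      (hfg : Function.Exact f g) (hg : Function.Surjective g) (M : ModuleSheaf R X)
        (hM : IsSheafFlat M) (U : Opens X) (h : TensorAcyclic P M U)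
    (h' : TensorAcyclic S M U) :
    TensorAcyclic Q M U :=
  subsingleton_H'_of_shortExact (tensorShortComplex_shortExact f g hf hfg hg M hM) U 1 h h'

lemma TensorAcyclic.of_equiv {P Q : Type u} [AddCommGroup P] [Module R P] [AddCommGroup Q]
    [Module R Q]
    (e : P ≃ₗ[R] Q) (M : ModuleSheaf R X) (U : Opens X)
      (h : TensorAcyclic P M U) : TensorAcyclic Q M U :=
  subsingleton_H'_of_iso
    ((sheafCompose _ (forget₂ (ModuleCat.{u} R) AddCommGrpCat.{u})).mapIso (tensorIso e M)) U 1 h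

lemma tensor_subsingleton (P : Type u) [AddCommGroup P] [Module R P] [Subsingleton P]
    (M : ModuleSheaf R X) (V : (Opens X)ᵒᵖ) :
    Subsingleton ((tensor P M).obj.obj V) := by
  have h : 𝟙 (tensor P M) = 0 := by
    rw [← tensorMap_id, ← tensorMap_zero, Subsingleton.elim (LinearMap.id : P →ₗ[R] P) 0]
  exact subsingleton_of_forall_eq 0 fun s => congr_arg (fun φ => φ.hom.app V s) h

lemma TensorAcyclic.of_subsingleton (P : Type u) [AddCommGroup P] [Module R P] [Subsingleton P]
    (M : ModuleSheaf R X) (U : Opens X) : TensorAcyclic P M U :=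
  subsingleton_H'_of_subsingleton (fun V => tensor_subsingleton P M V) U 1

/-- Induction on a composition series: each simple quotient is `R` modulo a maximal ideal, that is,
the residue field. -/
lemma TensorAcyclic.of_isFiniteLength [IsLocalRing R] (M : ModuleSheaf R X) (hM : IsSheafFlat M)
    (U : Opens X) (h : TensorAcyclic (IsLocalRing.ResidueField R) M U)
  (P : Type u) [AddCommGroup P] [Module R P] (hP : IsFiniteLength R P) : TensorAcyclic P M U := by
  induction hP with
  | of_subsingleton => exact .of_subsingleton _ M U
  | @of_simple_quotient P _ _ N _ _ ih =>
    refine .of_exact N.subtype N.mkQ N.subtype_injective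
      (LinearMap.exact_subtype_mkQ N) N.mkQ_surjective M hM U ih ?_
    obtain ⟨I, hI, ⟨e⟩⟩ := isSimpleModule_iff_quot_maximal.1
      (inferInstance : IsSimpleModule R (P ⧸ N))
    obtain rfl := IsLocalRing.eq_maximalIdeal hI
    exact h.of_equiv e.symm M U

end Tensor

/-! ### Completeness of a sheaf in terms of sections. -/

section AdicSheaf
variable {R : Type u} [CommRing R] {X : TopCat.{u}}

/-- The sections over `V` of the canonical homomorphism `𝓜 → A ⊗ 𝓜`. -/
abbrev toTensorSections (A : Type u) [CommRing A] [Algebra R A] (M : ModuleSheaf R X)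
    (V : Opens X) : M.obj.obj (op V) →ₗ[R] (tensor A M).obj.obj (op V) :=
  ((toTensor A M).hom.app (op V)).hom

/-- The sections over `V` of the homomorphism `P ⊗ 𝓜 → Q ⊗ 𝓜` induced by `f : P → Q`. -/
abbrev tensorMapSections {P Q : Type u} [AddCommGroup P] [Module R P] [AddCommGroup Q] [Module R Q]
    (f : P →ₗ[R] Q) (M : ModuleSheaf R X) (V : Opens X) :
    (tensor P M).obj.obj (op V) →ₗ[R] (tensor Q M).obj.obj (op V) :=
  ((tensorMap f M).hom.app (op V)).hom

lemma toTensorSections_eq (A : Type u) [CommRing A] [Algebra R A] (M : ModuleSheaf R X)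
    (V : Opens X) (s : M.obj.obj (op V)) :
    toTensorSections A M V s = tensorSections A M V (1 ⊗ₜ s) := rfl

lemma tensorMapSections_tensorSections {P Q : Type u} [AddCommGroup P] [Module R P]
    [AddCommGroup Q] [Module R Q] (f : P →ₗ[R] Q) (M : ModuleSheaf R X) (V : Opens X)
    (t : P ⊗[R] (M.obj.obj (op V))) :
    tensorMapSections f M V (tensorSections P M V t) = tensorSections Q M V (f.rTensor _ t) :=
  tensorMap_tensorSections f M V t

lemma tensorMapSections_comp {P Q S : Type u} [AddCommGroup P] [Module R P]
    [AddCommGroup Q] [Module R Q] [AddCommGroup S] [Module R S] (f : P →ₗ[R] Q) (g : Q →ₗ[R] S)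
    (M : ModuleSheaf R X) (V : Opens X) (t : (tensor P M).obj.obj (op V)) :
    tensorMapSections (g ∘ₗ f) M V t = tensorMapSections g M V (tensorMapSections f M V t) :=
  congr_arg (fun φ => φ.hom.app (op V) t) (tensorMap_comp f g M)

lemma powTransition_toTensorSections (I : Ideal R) {i j : ℕ} (h : i ≤ j) (M : ModuleSheaf R X)
    (V : Opens X) (s : M.obj.obj (op V)) :
    tensorMapSections (powTransition I h) M V (toTensorSections (R ⧸ I ^ (j + 1)) M V s) =
      toTensorSections (R ⧸ I ^ (i + 1)) M V s :=
  tensorMapSections_tensorSections _ _ _ _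

lemma powTransition_powTransition (I : Ideal R) {i j k : ℕ} (h : i ≤ j) (h' : j ≤ k)
    (M : ModuleSheaf R X) (V : Opens X) (t : (tensor (R ⧸ I ^ (k + 1)) M).obj.obj (op V)) :
    tensorMapSections (powTransition I h) M V (tensorMapSections (powTransition I h') M V t) =
      tensorMapSections (powTransition I (h.trans h')) M V t := by
  rw [powTransition_comp I h h', tensorMapSections_comp]

lemma exists_limit_section {J : Type} [SmallCategory J] (F : J ⥤ ModuleSheaf R X) (V : Opens X)
    {c : Cone F} (hc : IsLimit c)
    (t : ∀ i, (F.obj i).obj.obj (op V))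
    (ht : ∀ {i j} (f : i ⟶ j), (F.map f).hom.app (op V) (t i) = t j) :
    ∃ x : c.pt.obj.obj (op V), ∀ i, (c.π.app i).hom.app (op V) x = t i := by
  have h := isLimitOfPreserves (sheafToPresheaf _ _ ⋙ (evaluation _ _).obj (op V) ⋙
    forget (ModuleCat.{u} R)) hc
  obtain ⟨x, hx, -⟩ := (Types.isLimit_iff _).1 ⟨h⟩ t ht
  exact ⟨x, hx⟩

lemma limit_section_ext {J : Type} [SmallCategory J] (F : J ⥤ ModuleSheaf R X) (V : Opens X)
    {c : Cone F} (hc : IsLimit c) (x y : c.pt.obj.obj (op V))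
    (h : ∀ i, (c.π.app i).hom.app (op V) x = (c.π.app i).hom.app (op V) y) : x = y :=
  Concrete.isLimit_ext _ (isLimitOfPreserves (sheafToPresheaf _ _ ⋙ (evaluation _ _).obj (op V)) hc)
    x y h

/-- Limits of sheaves are computed on sections, so completeness becomes separatedness and the
lifting of compatible families over every open set. -/
lemma isSheafAdicComplete_iff (I : Ideal R) (M : ModuleSheaf R X) :
    IsSheafAdicComplete I M ↔ ∀ V : Opens X,
      (∀ s : M.obj.obj (op V), (∀ i : ℕ, toTensorSections (R ⧸ I ^ (i + 1)) M V s = 0) → s = 0) ∧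
      ∀ t : ∀ i : ℕ, (tensor (R ⧸ I ^ (i + 1)) M).obj.obj (op V),
        (∀ i j (h : i ≤ j), tensorMapSections (powTransition I h) M V (t j) = t i) →
        ∃ s : M.obj.obj (op V), ∀ i, toTensorSections (R ⧸ I ^ (i + 1)) M V s = t i := by
  constructor
  · intro (h : IsIso (toAdicCompletion I M)) V
    have hc : IsLimit (adicCone I M) :=
      have : IsIso ((limit.isLimit (adicSystem I M)).lift (adicCone I M)) := h
      IsLimit.ofPointIso (limit.isLimit _)
    refine ⟨fun s hs => limit_section_ext _ V hc s 0 fun i => (hs i.unop).trans (map_zero _).symm,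
      fun t ht => ?_⟩
    obtain ⟨s, hs⟩ := exists_limit_section _ V hc (fun i => t i.unop)
      (fun {i j} f => ht _ _ (leOfHom f.unop))
    exact ⟨s, fun i => hs (op i)⟩
  · intro h
    have hπ : ∀ (V : Opens X) (s : M.obj.obj (op V)) (i : ℕᵒᵖ),
      (limit.π (adicSystem I M) i).hom.app (op V) ((toAdicCompletion I M).hom.app (op V) s) =
        toTensorSections (R ⧸ I ^ (i.unop + 1)) M V s := fun V s i =>
      congr_arg (fun φ => φ.hom.app (op V) s) (limit.lift_π (adicCone I M) i)
    have : ∀ V, IsIso ((toAdicCompletion I M).hom.app V) := fun ⟨V⟩ => by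
      rw [ConcreteCategory.isIso_iff_bijective]
      constructor
      · refine (injective_iff_map_eq_zero _).2 fun s hs => (h V).1 s fun i => ?_
        exact (hπ V s (op i)).symm.trans ((congr_arg
          ((limit.π (adicSystem I M) (op i)).hom.app (op V)) hs).trans (map_zero _))
      · intro t
        obtain ⟨s, hs⟩ := (h V).2 (fun i => (limit.π (adicSystem I M) (op i)).hom.app (op V) t)
          (fun i j hij => congr_arg (fun φ => φ.hom.app (op V) t)
            (limit.w (adicSystem I M) (homOfLE hij).op))
        exact ⟨s, limit_section_ext _ V (limit.isLimit _) _ _ fun i => (hπ V s i).trans (hs i.unop)⟩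
    have : IsIso ((sheafToPresheaf _ _).map (toAdicCompletion I M)) := by
      change IsIso (toAdicCompletion I M).hom
      exact NatIso.isIso_of_isIso_app _
    exact isIso_of_reflects_iso _ (sheafToPresheaf _ _)

end AdicSheaf

/-! ### Complete filtrations and adic completeness of modules. -/

section Filtration
variable {R : Type*} [CommRing R] {M : Type*} [AddCommGroup M] [Module R M]

lemma exists_sum_smul_of_mem_span_smul {n : ℕ} (a : Fin n → R) (N : Submodule R M) {y : M}
    (hy : y ∈ Ideal.span (Set.range a) • N) :
    ∃ z : Fin n → M, (∀ l, z l ∈ N) ∧ y = ∑ l, a l • z l := by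
  refine Submodule.smul_induction_on hy (fun r hr m hm => ?_) ?_
  · obtain ⟨c, rfl⟩ := (Ideal.mem_span_range_iff_exists_fun).1 hr
    refine ⟨fun l => c l • m, fun l => N.smul_mem _ hm, ?_⟩
    rw [Finset.sum_smul]
    exact Finset.sum_congr rfl fun l _ => by rw [mul_comm, mul_smul]
  · rintro _ _ ⟨z, hz, rfl⟩ ⟨w, hw, rfl⟩
    exact ⟨fun l => z l + w l, fun l => N.add_mem (hz l) (hw l), by
      simp [smul_add, Finset.sum_add_distrib]⟩

/-- If `M` is complete for a filtration `F` with `F j ≤ I ^ j M + F (j + 1)`, then the filtration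
is the `I`-adic one. -/
lemma filtration_le_pow_smul_top (I : Ideal R) (hI : I.FG) (F : ℕ → Submodule R M)
    (hF : Antitone F) (hIF : ∀ k, I ^ k • (⊤ : Submodule R M) ≤ F k)
    (hstep : ∀ j, F j ≤ I ^ j • ⊤ ⊔ F (j + 1))
    (hsep : ∀ x, (∀ n, x ∈ F n) → x = 0)
    (hcomplete : ∀ x : ℕ → M, (∀ n, x (n + 1) - x n ∈ F n) → ∃ y, ∀ n, y - x n ∈ F n) (j : ℕ) :
    F j ≤ I ^ j • ⊤ := by
  intro x hx
  -- The generators `a` of `I ^ j` are fixed once: a correction in `I ^ (j + k) M` is `∑ a l • z l`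
  -- with `z l ∈ I ^ k M`, so for each `l` the `z l` sum to a convergent series, and the total stays
  -- in `I ^ j M`.
  obtain ⟨n, a, ha⟩ := Submodule.fg_iff_exists_fin_generating_family.1 (hI.pow (n := j))
  have hstep' : ∀ k, ∀ r : F (j + k), ∃ (z : Fin n → M) (r' : F (j + (k + 1))),
      (∀ l, z l ∈ I ^ k • (⊤ : Submodule R M)) ∧ (r : M) = ∑ l, a l • z l + r' := by
    rintro k ⟨r, hr⟩
    obtain ⟨y, hy, r', hr', rfl⟩ := Submodule.mem_sup.1 (hstep _ hr)
    rw [pow_add, mul_smul, ← ha] at hy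
    obtain ⟨z, hz, rfl⟩ := exists_sum_smul_of_mem_span_smul a _ hy
    exact ⟨z, ⟨r', hr'⟩, hz, rfl⟩
  choose z r' hz hr' using hstep'
  let r : ∀ k, F (j + k) := fun k =>
    Nat.rec (motive := fun k => F (j + k)) ⟨x, hx⟩ (fun k r => r' k r) k
  let s : Fin n → ℕ → M := fun l k => ∑ i ∈ Finset.range k, z i (r i) l
  have hs : ∀ k, x = ∑ l, a l • s l k + (r k : M) := by
    intro k
    induction k with
    | zero => simp [s, r]
    | succ k ih =>
      have h : (r k : M) = ∑ l, a l • z k (r k) l + r (k + 1) := hr' k (r k)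
      rw [ih, h]
      simp only [s, Finset.sum_range_succ, smul_add, Finset.sum_add_distrib, add_assoc]
  have hw : ∀ l, ∃ y, ∀ k, y - s l k ∈ F k := fun l => hcomplete _ fun k => by
    simp only [s, Finset.sum_range_succ, add_sub_cancel_left]
    exact hIF _ (hz k _ l)
  choose w hw using hw
  -- The remainder and the tails of the series all lie in `F k`, for every `k`.
  have hxw : x - ∑ l, a l • w l = 0 := hsep _ fun k => by
    have h : x - ∑ l, a l • w l = r k - ∑ l, a l • (w l - s l k) := by
      nth_rw 1 [hs k]
      simp only [smul_sub, Finset.sum_sub_distrib]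
      abel
    rw [h]
    exact sub_mem (hF (Nat.le_add_left k j) (r k).2)
      (sum_mem fun l _ => Submodule.smul_mem _ _ (hw l k))
  rw [sub_eq_zero.1 hxw]
  refine sum_mem fun l _ => Submodule.smul_mem_smul ?_ trivial
  rw [← ha]
  exact Submodule.subset_span ⟨l, rfl⟩

lemma isAdicComplete_of_filtration (I : Ideal R) (F : ℕ → Submodule R M)
    (hF : ∀ k, F k = I ^ k • ⊤)
    (hsep : ∀ x, (∀ n, x ∈ F n) → x = 0)
    (hcomplete : ∀ x : ℕ → M, (∀ n, x (n + 1) - x n ∈ F n) → ∃ y, ∀ n, y - x n ∈ F n) :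
    IsAdicComplete I M where
  haus' x hx := hsep x fun n => by
    rw [hF]
    exact SModEq.zero.1 (hx n)
  prec' f hf := by
    obtain ⟨y, hy⟩ := hcomplete f fun n => by
      rw [hF]
      exact SModEq.sub_mem.1 (hf n.le_succ).symm
    refine ⟨y, fun n => (SModEq.sub_mem.2 ?_).symm⟩
    rw [← hF]
    exact hy n

lemma exists_adic_limit (I : Ideal R) [IsAdicComplete I M] (x : ℕ → M)
    (hx : ∀ n, x (n + 1) - x n ∈ I ^ n • (⊤ : Submodule R M)) :
    ∃ y, ∀ n, y - x n ∈ I ^ n • (⊤ : Submodule R M) := by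
  obtain ⟨y, hy⟩ := IsPrecomplete.prec (inferInstance : IsPrecomplete I M) (f := x)
    (fun {m n} h => by
      induction n, h using Nat.le_induction with
      | base => exact SModEq.rfl
      | succ n hmn ih =>
        exact ih.trans (SModEq.mono (Submodule.smul_mono_left (Ideal.pow_le_pow_right hmn))
          (SModEq.sub_mem.2 (hx n)).symm))
  exact ⟨y, fun n => SModEq.sub_mem.1 (hy n).symm⟩

lemma eq_zero_of_forall_mem_pow (I : Ideal R) [IsAdicComplete I M] (x : M)
    (hx : ∀ n, x ∈ I ^ n • (⊤ : Submodule R M)) : x = 0 :=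
  IsHausdorff.haus (inferInstance : IsHausdorff I M) x fun n => SModEq.zero.2 (hx n)

lemma isAdicComplete_pow_smul_top (I : Ideal R) [IsAdicComplete I M] (i : ℕ) :
    IsAdicComplete I (I ^ i • ⊤ : Submodule R M) := by
  have hmem : ∀ (n : ℕ) (x : (I ^ i • ⊤ : Submodule R M)),
      x ∈ I ^ n • (⊤ : Submodule R (I ^ i • ⊤ : Submodule R M)) ↔
        (x : M) ∈ I ^ (n + i) • (⊤ : Submodule R M) := fun n x => by
    rw [Submodule.mem_smul_top_iff, pow_add, mul_smul]
  refine isAdicComplete_of_filtration I _ (fun _ => rfl) (fun x hx => ?_) (fun x hx => ?_)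
  · refine Subtype.ext (eq_zero_of_forall_mem_pow I _ fun n => ?_)
    exact Submodule.smul_mono_left (Ideal.pow_le_pow_right (Nat.le_add_right n i))
      ((hmem n x).1 (hx n))
  -- Level `n` of the submodule is level `n + i` of `M`, so the sequence is delayed by `i`;
  -- truncated subtraction keeps it constant for `n ≤ i`.
  · obtain ⟨y, hy⟩ := exists_adic_limit I (fun n => (x (n - i) : M)) fun n => by
      rcases le_or_gt i n with h | h
      · obtain ⟨k, rfl⟩ := Nat.exists_eq_add_of_le' h
        have := (hmem k _).1 (hx k)
        rwa [Nat.add_right_comm, Nat.add_sub_cancel, Nat.add_sub_cancel]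
      · have h1 : n + 1 - i = n - i := by omega
        rw [h1, sub_self]
        exact zero_mem _
    have hy' : ∀ n, y - x n ∈ I ^ (n + i) • (⊤ : Submodule R M) := fun n => by
      simpa using hy (n + i)
    have hyi : y ∈ I ^ i • (⊤ : Submodule R M) := by
      have := hy' 0
      rw [zero_add] at this
      simpa using add_mem this (x 0).2
    exact ⟨⟨y, hyi⟩, fun n => (hmem n _).2 (hy' n)⟩

end Filtration

/-! ### Finite length of the quotients `R/m^n`. -/

section FiniteLength
variable {R : Type*} [CommRing R] [IsLocalRing R] [IsNoetherianRing R]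

/-- For `n > 0` a prime containing `m^n` contains `m`, so `m` is minimal over `m^n` and the quotient
is artinian. -/
lemma isFiniteLength_quotient_pow (n : ℕ) :
    IsFiniteLength R (R ⧸ IsLocalRing.maximalIdeal R ^ n) := by
  rcases Nat.eq_zero_or_pos n with rfl | hn
  · have : Subsingleton (R ⧸ IsLocalRing.maximalIdeal R ^ 0) := by
      rw [pow_zero]
      exact Ideal.Quotient.subsingleton_iff.2 Ideal.one_eq_top
    exact .of_subsingleton
  · have h : IsLocalRing.maximalIdeal R ∈ (IsLocalRing.maximalIdeal R ^ n).minimalPrimes :=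
      ⟨⟨inferInstance, Ideal.pow_le_self hn.ne'⟩, fun q hq _ => hq.1.le_of_pow_le hq.2⟩
    have := IsLocalRing.quotient_artinian_of_mem_minimalPrimes_of_isLocalRing _ h
    have : IsArtinian R (R ⧸ IsLocalRing.maximalIdeal R ^ n) :=
      isArtinian_of_surjective_algebraMap (R := R ⧸ IsLocalRing.maximalIdeal R ^ n)
        Ideal.Quotient.mk_surjective
    exact isFiniteLength_iff_isNoetherian_isArtinian.2 ⟨inferInstance, inferInstance⟩

lemma isFiniteLength_submodule {R : Type*} [CommRing R] {P : Type*} [AddCommGroup P] [Module R P]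
    (h : IsFiniteLength R P)
    (N : Submodule R P) : IsFiniteLength R N := by
  obtain ⟨_, _⟩ := isFiniteLength_iff_isNoetherian_isArtinian.1 h
  exact isFiniteLength_iff_isNoetherian_isArtinian.2 ⟨inferInstance, inferInstance⟩

end FiniteLength

/-! ### Lifted bases of `M/mM` and their independence modulo powers of `m`. -/

section Flat
variable {R : Type*} [CommRing R]

open IsLocalRing

/-- There is a family in `M` lifting a basis of `M / m M`. -/
lemma exists_lift_basis (R : Type*) [CommRing R] [IsLocalRing R] (M : Type u) [AddCommGroup M]
    [Module R M] :
    ∃ (Z : Type u) (e : Z → M) (coord : Z → M →ₗ[R] R ⧸ maximalIdeal R),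
      (∀ z, coord z (e z) = 1) ∧ (∀ z w, z ≠ w → coord z (e w) = 0) ∧
      ∀ x : M, ∃ c : Z →₀ R, x - c.sum (fun z r => r • e z) ∈ maximalIdeal R •
        (⊤ : Submodule R M) := by
  classical
  let _ : Field (R ⧸ maximalIdeal R) := Ideal.Quotient.field _
  let b := Module.Basis.ofVectorSpace (R ⧸ maximalIdeal R)
    (M ⧸ maximalIdeal R • (⊤ : Submodule R M))
  choose e he using fun z => Submodule.mkQ_surjective (maximalIdeal R • (⊤ : Submodule R M)) (b z)
  refine ⟨_, e, fun z => ((b.coord z).restrictScalars R) ∘ₗ Submodule.mkQ _, fun z => ?_,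
    fun z w h => ?_,
    fun x => ?_⟩
  · simp [he]
  · simp [he, h.symm]
  · choose g hg using Ideal.Quotient.mk_surjective (I := maximalIdeal R)
    refine ⟨Finsupp.onFinset (b.repr (Submodule.mkQ _ x)).support
      (fun z => if b.repr (Submodule.mkQ _ x) z = 0 then 0 else g (b.repr (Submodule.mkQ _ x) z))
        (fun z hz => by
        rw [Finsupp.mem_support_iff]
        exact fun h => hz (if_pos h)), ?_⟩
    rw [← Submodule.Quotient.mk_eq_zero, Submodule.Quotient.mk_sub, sub_eq_zero,
      Finsupp.onFinset_sum _ (by simp)]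
    have h1 := b.linearCombination_repr (Submodule.mkQ _ x)
    rw [Finsupp.linearCombination_apply, Finsupp.sum] at h1
    refine h1.symm.trans ?_
    change _ = Submodule.mkQ _ _
    rw [map_sum]
    refine Finset.sum_congr rfl fun z hz => ?_
    rw [if_neg (Finsupp.mem_support_iff.1 hz), map_smul, he]
    conv_lhs => rw [← hg (b.repr (Submodule.mkQ _ x) z)]
    rfl

/-- The ideal `m ^ k / m ^ (k + 1)` of `R / m ^ (k + 1)`. -/
abbrev gradedPiece (I : Ideal R) (k : ℕ) : Submodule R (R ⧸ I ^ (k + 1)) :=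
  Submodule.map (Submodule.mkQ (I ^ (k + 1))) (I ^ k)

variable [IsLocalRing R] {M : Type*} [AddCommGroup M] [Module R M]
  {Z : Type*} {e : Z → M} {coord : Z → M →ₗ[R] R ⧸ maximalIdeal R}

/-- The leading coefficients give a tensor in `m^k/m^(k+1) ⊗ M` which vanishes in `R/m^(k+1) ⊗ M`,
hence vanishes by `hgr`. Applying `coord z`, a dual basis vector, isolates the class of `c z`. -/
lemma mem_pow_succ_of_sum_mem (h₁ : ∀ z, coord z (e z) = 1) (h₂ : ∀ z w, z ≠ w → coord z (e w) = 0)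
    (k : ℕ) (hgr : Function.Injective ((gradedPiece (maximalIdeal R) k).subtype.rTensor M))
    (c : Z →₀ R) (hc : ∀ z, c z ∈ maximalIdeal R ^ k)
    (hsum : c.sum (fun z r => r • e z) ∈ maximalIdeal R ^ (k + 1) • (⊤ : Submodule R M)) (z : Z) :
    c z ∈ maximalIdeal R ^ (k + 1) := by
  let cl : Z → gradedPiece (maximalIdeal R) k := fun z =>
    ⟨Submodule.mkQ _ (c z), Submodule.mem_map_of_mem (hc z)⟩
  let τ : gradedPiece (maximalIdeal R) k ⊗[R] M := ∑ z ∈ c.support, cl z ⊗ₜ e z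
  have hτ : τ = 0 := by
    apply hgr
    rw [map_zero]
    apply (TensorProduct.quotTensorEquivQuotSMul M (maximalIdeal R ^ (k + 1))).injective
    rw [map_zero, map_sum, map_sum]
    rw [← Submodule.Quotient.mk_eq_zero] at hsum
    refine Eq.trans ?_ hsum
    change _ = Submodule.mkQ _ _
    rw [Finsupp.sum, map_sum]
    exact Finset.sum_congr rfl fun z _ => TensorProduct.quotTensorEquivQuotSMul_mk_tmul _ _ _
  have h := congr_arg (fun t => TensorProduct.tensorQuotEquivQuotSMul _ (maximalIdeal R)
    ((coord z).lTensor (gradedPiece (maximalIdeal R) k) t)) hτ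
  simp only [τ, map_sum, LinearMap.lTensor_tmul, map_zero] at h
  rw [Finset.sum_eq_single z, h₁] at h
  · have h' := TensorProduct.tensorQuotEquivQuotSMul_tmul_mk (maximalIdeal R) (cl z) 1
    -- The class of `c z` lies in `m • (m^k/m^(k+1))`, the image of `m^(k+1)`.
    rw [map_one, h, eq_comm, Submodule.Quotient.mk_eq_zero, one_smul, Submodule.mem_smul_top_iff,
      ← Submodule.map_smul'', smul_eq_mul, ← pow_succ'] at h'
    obtain ⟨y, hy, hyz⟩ := h'
    have h3 : c z - y ∈ maximalIdeal R ^ (k + 1) := (Submodule.Quotient.eq _).1 hyz.symm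
    simpa using add_mem h3 hy
  · intro w _ hw
    rw [h₂ z w hw.symm, TensorProduct.tmul_zero, map_zero]
  · intro hz
    have hz : c z = 0 := Finsupp.notMem_support_iff.1 hz
    have : cl z = 0 := Subtype.ext (by simp [cl, hz])
    rw [this, TensorProduct.zero_tmul, map_zero]

lemma mem_pow_of_sum_mem (h₁ : ∀ z, coord z (e z) = 1) (h₂ : ∀ z w, z ≠ w → coord z (e w) = 0)
    (hgr : ∀ k, Function.Injective ((gradedPiece (maximalIdeal R) k).subtype.rTensor M))
    (n : ℕ) (c : Z →₀ R)
    (hsum : c.sum (fun z r => r • e z) ∈ maximalIdeal R ^ n • (⊤ : Submodule R M)) (z : Z) :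
    c z ∈ maximalIdeal R ^ n := by
  induction n generalizing z with
  | zero => simp
  | succ k ih =>
    exact mem_pow_succ_of_sum_mem h₁ h₂ k (hgr k) c
      (ih (Submodule.smul_mono_left (Ideal.pow_le_pow_right k.le_succ) hsum)) hsum z

/-- The error modulo `m` is a sum of terms `r • y` with `r ∈ m`; approximating each `y` modulo `m^n`
gains one power. -/
lemma exists_sum_sub_mem_pow
    (h₃ : ∀ x : M, ∃ c : Z →₀ R, x - c.sum (fun z r => r • e z) ∈ maximalIdeal R •
      (⊤ : Submodule R M))
    (n : ℕ) (x : M) : ∃ c : Z →₀ R, x - c.sum (fun z r => r • e z) ∈ maximalIdeal R ^ n •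
      (⊤ : Submodule R M) := by
  classical
  change ∃ c, x - Finsupp.linearCombination R e c ∈ _
  induction n generalizing x with
  | zero => exact ⟨0, by simp⟩
  | succ n ih =>
    obtain ⟨c, hc⟩ := h₃ x
    have key : ∀ y ∈ maximalIdeal R • (⊤ : Submodule R M), ∃ c : Z →₀ R,
        y - Finsupp.linearCombination R e c ∈ maximalIdeal R ^ (n + 1) • (⊤ : Submodule R M) :=
          fun y hy => by
      refine Submodule.smul_induction_on hy (fun r hr m _ => ?_) ?_
      · obtain ⟨d, hd⟩ := ih m
        refine ⟨r • d, ?_⟩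
        rw [map_smul, ← smul_sub, pow_succ', mul_smul]
        exact Submodule.smul_mem_smul hr hd
      · rintro y y' ⟨d, hd⟩ ⟨d', hd'⟩
        refine ⟨d + d', ?_⟩
        rw [map_add, add_sub_add_comm]
        exact add_mem hd hd'
    obtain ⟨d, hd⟩ := key _ hc
    refine ⟨c + d, ?_⟩
    rw [map_add, ← sub_sub]
    exact hd
end Flat

/-! ### Convergent series in a complete module. -/

section Expansion
variable {R : Type*} [CommRing R] {M : Type*} [AddCommGroup M] [Module R M] {Z : Type*}

/-- The element `x` is the sum of the `I`-adically convergent series `∑ c z • e z`, where `c z`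
tends to zero along the cofinite filter. -/
def IsAdicExpansion (I : Ideal R) (e : Z → M) (c : Z → R) (x : M) : Prop :=
  ∀ n, ∃ c' : Z →₀ R, (∀ z, c z - c' z ∈ I ^ n) ∧
    x - Finsupp.linearCombination R e c' ∈ I ^ n • (⊤ : Submodule R M)

variable {I : Ideal R} {e : Z → M} {c d : Z → R} {x y : M}

lemma IsAdicExpansion.add (hc : IsAdicExpansion I e c x) (hd : IsAdicExpansion I e d y) :
    IsAdicExpansion I e (c + d) (x + y) := fun n => by
  obtain ⟨c', hc', hx⟩ := hc n
  obtain ⟨d', hd', hy⟩ := hd n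
  refine ⟨c' + d', fun z => ?_, ?_⟩
  · simpa [add_sub_add_comm] using add_mem (hc' z) (hd' z)
  · rw [map_add, add_sub_add_comm]
    exact add_mem hx hy

lemma IsAdicExpansion.smul (r : R) (hc : IsAdicExpansion I e c x) :
    IsAdicExpansion I e (r • c) (r • x) := fun n => by
  obtain ⟨c', hc', hx⟩ := hc n
  refine ⟨r • c', fun z => ?_, ?_⟩
  · simpa [mul_sub] using Ideal.mul_mem_left _ r (hc' z)
  · rw [map_smul, ← smul_sub]
    exact Submodule.smul_mem _ r hx

lemma IsAdicExpansion.zero : IsAdicExpansion I e (0 : Z → R) 0 := fun n => ⟨0, by simp, by simp⟩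

lemma IsAdicExpansion.sum {ι : Type*} (s : Finset ι) {c : ι → Z → R} {x : ι → M}
    (h : ∀ i, IsAdicExpansion I e (c i) (x i)) :
    IsAdicExpansion I e (∑ i ∈ s, c i) (∑ i ∈ s, x i) := by
  classical
  induction s using Finset.induction_on with
  | empty => simpa using IsAdicExpansion.zero
  | insert a s ha ih =>
    rw [Finset.sum_insert ha, Finset.sum_insert ha]
    exact (h a).add ih

lemma linearCombination_mem_pow_smul {n : ℕ} (c : Z →₀ R) (h : ∀ z, c z ∈ I ^ n) :
    Finsupp.linearCombination R e c ∈ I ^ n • (⊤ : Submodule R M) := by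
  rw [Finsupp.linearCombination_apply]
  exact Submodule.sum_mem _ fun z _ => Submodule.smul_mem_smul (h z) trivial

lemma IsAdicExpansion.unique [IsAdicComplete I M] (h : IsAdicExpansion I e c x)
    (h' : IsAdicExpansion I e c y) : x = y := by
  rw [← sub_eq_zero]
  refine eq_zero_of_forall_mem_pow I _ fun n => ?_
  obtain ⟨c', hc', hx⟩ := h n
  obtain ⟨d', hd', hy⟩ := h' n
  have h1 : Finsupp.linearCombination R e (c' - d') ∈ I ^ n • (⊤ : Submodule R M) :=
    linearCombination_mem_pow_smul _ fun z => by
      have := sub_mem (hd' z) (hc' z)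
      simpa using this
  rw [map_sub] at h1
  have := add_mem (sub_mem hx hy) h1
  convert this using 1
  abel

lemma IsAdicExpansion.finite (h : IsAdicExpansion I e c x) (n : ℕ) : {z | c z ∉ I ^ n}.Finite := by
  obtain ⟨c', hc', -⟩ := h n
  refine c'.hasFiniteSupport.subset fun z hz => ?_
  rw [Function.mem_support]
  intro h0
  have := hc' z
  rw [h0, sub_zero] at this
  exact hz this

/-- Dropping the coefficients in `I ^ n` leaves a finite sum, and consecutive truncations agree
modulo `I ^ n`. -/
lemma exists_isAdicExpansion [IsAdicComplete I M] (hc : ∀ n, {z | c z ∉ I ^ n}.Finite) :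
    ∃ x, IsAdicExpansion I e c x := by
  classical
  let c' : ℕ → Z →₀ R := fun n => Finsupp.onFinset (hc n).toFinset
    (fun z => if c z ∈ I ^ n then 0 else c z) (fun z hz => by
      rw [Set.Finite.mem_toFinset]
      exact fun h => hz (if_pos h))
  have hc' : ∀ n z, c z - c' n z ∈ I ^ n := fun n z => by
    by_cases h : c z ∈ I ^ n <;> simp [c', h]
  obtain ⟨x, hx⟩ := exists_adic_limit I (fun n => Finsupp.linearCombination R e (c' n)) fun n => by
    rw [← map_sub]
    refine linearCombination_mem_pow_smul _ fun z => ?_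
    have := sub_mem (hc' n z) (Ideal.pow_le_pow_right n.le_succ (hc' (n + 1) z))
    simpa using this
  exact ⟨x, fun n => ⟨c' n, hc' n, hx n⟩⟩

variable [IsAdicComplete I R]

lemma eq_zero_of_forall_mem_ideal_pow (r : R) (h : ∀ n, r ∈ I ^ n) : r = 0 :=
  eq_zero_of_forall_mem_pow I r fun n => by simpa using h n

lemma IsAdicExpansion.eq_zero (he : ∀ n (c : Z →₀ R),
      Finsupp.linearCombination R e c ∈ I ^ n • (⊤ : Submodule R M) → ∀ z, c z ∈ I ^ n)
    (h : IsAdicExpansion I e c 0) : c = 0 := by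
  funext z
  refine eq_zero_of_forall_mem_ideal_pow (I := I) _ fun n => ?_
  obtain ⟨c', hc', hx⟩ := h n
  rw [zero_sub, neg_mem_iff] at hx
  simpa using add_mem (hc' z) (he n c' hx z)

/-- By `he`, successive approximations of `x` have coefficients that agree modulo `I ^ n`, so the
coefficients converge in the complete ring `R`. -/
lemma exists_isAdicExpansion_of_generating (he : ∀ n (c : Z →₀ R),
      Finsupp.linearCombination R e c ∈ I ^ n • (⊤ : Submodule R M) → ∀ z, c z ∈ I ^ n)
    (hgen : ∀ n (x : M), ∃ c : Z →₀ R,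
      x - Finsupp.linearCombination R e c ∈ I ^ n • (⊤ : Submodule R M)) (x : M) :
    ∃ c, IsAdicExpansion I e c x := by
  choose c' hc' using fun n => hgen n x
  have h : ∀ z, ∃ r, ∀ n, r - c' n z ∈ I ^ n • (⊤ : Submodule R R) := fun z =>
    exists_adic_limit I (fun n => c' n z) fun n => by
      have h1 := sub_mem (hc' n)
        (Submodule.smul_mono_left (Ideal.pow_le_pow_right n.le_succ) (hc' (n + 1)))
      rw [sub_sub_sub_cancel_left, ← map_sub] at h1
      simpa using he n _ h1 z
  choose c hc using h
  exact ⟨c, fun n => ⟨c' n, fun z => by simpa using hc z n, hc' n⟩⟩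

end Expansion

/-! ### Artin–Rees control of coefficients. -/

section ArtinRees
variable {R : Type*} [CommRing R] [IsNoetherianRing R] (I : Ideal R) [IsAdicComplete I R]

lemma mem_pow_smul_top_pi {R : Type*} [CommRing R] (I : Ideal R) {ι : Type*}
    [Fintype ι] {n : ℕ} {v : ι → R} (h : ∀ i, v i ∈ I ^ n) :
    v ∈ I ^ n • (⊤ : Submodule R (ι → R)) := by
  classical
  rw [pi_eq_sum_univ v]
  exact sum_mem fun i _ => Submodule.smul_mem_smul (h i) trivial

/-- A submodule `L` of `R ^ l` has a finite generating family such that the coefficients of elements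
of `L` that are close to zero can be chosen close to zero. -/
lemma exists_generators_small_coefficients {l : ℕ} (L : Submodule R (Fin l → R)) :
    ∃ (s k : ℕ) (b : Fin s → Fin l → R), (∀ j, b j ∈ L) ∧ ∀ v ∈ L, ∃ d : Fin s → R,
      v = ∑ j, d j • b j ∧ ∀ n, (∀ i, v i ∈ I ^ (n + k)) → ∀ j, d j ∈ I ^ n := by
  obtain ⟨s, b, hb⟩ := Submodule.fg_iff_exists_fin_generating_family.1 (IsNoetherian.noetherian L)
  obtain ⟨k, hk⟩ := Ideal.exists_pow_inf_eq_pow_smul I L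
  have key : ∀ n, ∀ v ∈ L, (∀ i, v i ∈ I ^ (n + k)) →
      ∃ d : Fin s → R, v = ∑ j, d j • b j ∧ ∀ j, d j ∈ I ^ n := fun n v hv hvn => by
    have h1 : v ∈ I ^ n • Submodule.span R (Set.range b) := by
      have h2 : v ∈ I ^ (n + k) • ⊤ ⊓ L := ⟨mem_pow_smul_top_pi I hvn, hv⟩
      rw [hk _ (Nat.le_add_left k n), Nat.add_sub_cancel] at h2
      rw [hb]
      exact Submodule.smul_mono le_rfl inf_le_right h2
    obtain ⟨d, hd, rfl⟩ := (Submodule.mem_ideal_smul_span_iff_exists_sum _ _ _).1 h1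
    refine ⟨d, ?_, hd⟩
    rw [Finsupp.sum_fintype _ _ (by simp)]
  refine ⟨s, k, b, fun j => hb ▸ Submodule.subset_span ⟨j, rfl⟩, fun v hv => ?_⟩
  -- `key` yields a `d` for each `n`, but one `d` must serve all: take it at the last `n` for which
  -- `v` is small, namely `N - 1`. If there is no last one then `v = 0`; if `N = 0` the smallness
  -- condition is void.
  by_cases h0 : ∀ n, ∀ i, v i ∈ I ^ (n + k)
  · refine ⟨0, ?_, fun n _ j => zero_mem _⟩
    have : v = 0 := funext fun i => eq_zero_of_forall_mem_ideal_pow (I := I) _ fun n =>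
      Ideal.pow_le_pow_right (Nat.le_add_right n k) (h0 n i)
    simp [this]
  · classical
    push Not at h0
    let N := Nat.find h0
    have hN : ∃ i, v i ∉ I ^ (N + k) := Nat.find_spec h0
    have hlt : ∀ n, (∀ i, v i ∈ I ^ (n + k)) → n < N := fun n hn => by
      by_contra! h
      obtain ⟨i, hi⟩ := hN
      exact hi (Ideal.pow_le_pow_right (by omega) (hn i))
    have hmin : ∀ n < N, ∀ i, v i ∈ I ^ (n + k) := fun n hn => by
      have := Nat.find_min h0 hn
      push Not at this
      exact this
    rcases Nat.eq_zero_or_pos N with h | h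
    · have hv' := hv
      rw [← hb] at hv'
      obtain ⟨d, hd⟩ := (Submodule.mem_span_range_iff_exists_fun R).1 hv'
      exact ⟨d, hd.symm, fun n hn => absurd (hlt n hn) (by omega)⟩
    · obtain ⟨d, hd, hd'⟩ := key (N - 1) v hv (hmin _ (by omega))
      exact ⟨d, hd, fun n hn j => Ideal.pow_le_pow_right (by have := hlt n hn; omega) (hd' j)⟩

end ArtinRees

/-! ### Flatness of complete modules. -/

section Flatness
variable {R : Type*} [CommRing R] [IsNoetherianRing R]

/-- Equational criterion: expand a relation `∑ f i • x i = 0`. By uniqueness, for each `z` the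
coefficient vector is a syzygy of `f`, hence a combination of finitely many generators `b j`.
Summing the combination coefficients against `e z` gives elements `y j` that trivialize the
relation. -/
lemma flat_of_expansion {M : Type*} [AddCommGroup M] [Module R M] (I : Ideal R)
    [IsAdicComplete I R] [IsAdicComplete I M] {Z : Type*} (e : Z → M)
    (he : ∀ n (c : Z →₀ R),
      Finsupp.linearCombination R e c ∈ I ^ n • (⊤ : Submodule R M) → ∀ z, c z ∈ I ^ n)
    (hgen : ∀ n (x : M), ∃ c : Z →₀ R,
      x - Finsupp.linearCombination R e c ∈ I ^ n • (⊤ : Submodule R M)) :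
    Module.Flat R M := by
  rw [Module.Flat.iff_forall_isTrivialRelation]
  intro l f x hfx
  choose c hc using fun i => exists_isAdicExpansion_of_generating he hgen (x i)
  have hfc : ∑ i, f i • c i = 0 := by
    refine IsAdicExpansion.eq_zero he ?_
    rw [← hfx]
    exact IsAdicExpansion.sum _ fun i => (hc i).smul (f i)
  let L : Submodule R (Fin l → R) := LinearMap.ker (Fintype.linearCombination R f)
  obtain ⟨s, k, b, hb, hL⟩ := exists_generators_small_coefficients I L
  have hcL : ∀ z, (fun i => c i z) ∈ L := fun z => by
    rw [LinearMap.mem_ker, Fintype.linearCombination_apply]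
    simpa [mul_comm] using congr_fun hfc z
  choose d hd hd' using fun z => hL _ (hcL z)
  -- The Artin–Rees control of `d` makes the series defining `y j` converge.
  have hfin : ∀ j n, {z | d z j ∉ I ^ n}.Finite := fun j n => by
    refine (Set.finite_iUnion fun i => (hc i).finite (n + k)).subset fun z hz => ?_
    by_contra h
    simp only [Set.mem_iUnion, not_exists, Set.mem_ofPred_eq, not_not] at h
    exact hz (hd' z n h j)
  choose y hy using fun j => exists_isAdicExpansion (I := I) (e := e) (hfin j)
  refine ⟨s, fun i j => b j i, y, fun i => ?_, fun j => ?_⟩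
  · refine (hc i).unique ?_
    have : c i = ∑ j, b j i • fun z => d z j := by
      funext z
      simpa [mul_comm] using congr_fun (hd z) i
    rw [this]
    exact IsAdicExpansion.sum _ fun j => (hy j).smul (b j i)
  · have := hb j
    rw [LinearMap.mem_ker, Fintype.linearCombination_apply] at this
    simpa [mul_comm] using this

open IsLocalRing in
/-- A version of the local criterion for flatness, for complete modules. -/
lemma flat_of_isAdicComplete [IsLocalRing R] [IsAdicComplete (maximalIdeal R) R]
    (M : Type u) [AddCommGroup M] [Module R M] [IsAdicComplete (maximalIdeal R) M]
    (hgr : ∀ k, Function.Injective ((gradedPiece (maximalIdeal R) k).subtype.rTensor M)) :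
    Module.Flat R M := by
  obtain ⟨Z, e, coord, h₁, h₂, h₃⟩ := exists_lift_basis R M
  exact flat_of_expansion (maximalIdeal R) e (fun n c => mem_pow_of_sum_mem h₁ h₂ hgr n c)
    (exists_sum_sub_mem_pow h₃)

end Flatness

/-! ### Local arguments for sheaves and sheafifications. -/

section LocalSections
variable {R : Type u} [CommRing R] {X : TopCat.{u}}

lemma eq_zero_of_locally_eq_zero (F : ModuleSheaf R X) (V : Opens X) (s : F.obj.obj (op V))
    (h : ∀ x ∈ V, ∃ (W : Opens X) (i : W ⟶ V), x ∈ W ∧ F.obj.map i.op s = 0) : s = 0 := by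
  have hF : Presieve.IsSeparated (Opens.grothendieckTopology X) (F.obj ⋙ forget _) :=
    Presieve.IsSheaf.isSeparated ((isSheaf_iff_isSheaf_of_type _ _).1
      ((sheafCompose _ (forget (ModuleCat.{u} R))).obj F).2)
  refine (hF (Presheaf.equalizerSieve (F := F.obj) (X := op V) s 0) fun x hx => ?_).ext
    fun _ _ hf => hf
  obtain ⟨W, i, hxW, hi⟩ := h x hx
  exact ⟨W, i, hi.trans (map_zero _).symm, hxW⟩

lemma exists_local_preimage (F : (Opens X)ᵒᵖ ⥤ ModuleCat.{u} R) (V : Opens X)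
    (s : ((presheafToSheaf (Opens.grothendieckTopology X) _).obj F).obj.obj (op V)) (x : X)
    (hx : x ∈ V) : ∃ (W : Opens X) (i : W ⟶ V) (t : F.obj (op W)), x ∈ W ∧
      (toSheafify (Opens.grothendieckTopology X) F).app (op W) t =
        ((presheafToSheaf (Opens.grothendieckTopology X) _).obj F).obj.map i.op s := by
  obtain ⟨W, i, ⟨t, ht⟩, hxW⟩ := Presheaf.imageSieve_mem (Opens.grothendieckTopology X)
    (toSheafify (Opens.grothendieckTopology X) F) (U := op V) s x hx
  exact ⟨W, i, t, hxW, ht⟩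

lemma locally_eq_zero_of_toSheafify_eq_zero (F : (Opens X)ᵒᵖ ⥤ ModuleCat.{u} R) (V : Opens X)
    (s : F.obj (op V)) (hs : (toSheafify (Opens.grothendieckTopology X) F).app (op V) s = 0)
    (x : X) (hx : x ∈ V) : ∃ (W : Opens X) (i : W ⟶ V), x ∈ W ∧ F.map i.op s = 0 := by
  obtain ⟨W, i, hi, hxW⟩ := Presheaf.equalizerSieve_mem (Opens.grothendieckTopology X)
    (toSheafify (Opens.grothendieckTopology X) F) s 0 (hs.trans (map_zero _).symm) x hx
  exact ⟨W, i, hxW, Eq.trans hi (map_zero _)⟩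

/-- A homomorphism out of a sheafification is injective on sections if its composition with the
sheafification map is locally injective. -/
lemma injective_of_locally_injective_toSheafify (F : (Opens X)ᵒᵖ ⥤ ModuleCat.{u} R)
    (G : ModuleSheaf R X) (φ : (presheafToSheaf (Opens.grothendieckTopology X) _).obj F ⟶ G)
    (h : Presheaf.IsLocallyInjective (Opens.grothendieckTopology X)
      (toSheafify (Opens.grothendieckTopology X) F ≫ φ.hom)) (V : (Opens X)ᵒᵖ) :
    Function.Injective (φ.hom.app V) := by
  revert V
  rw [← Sheaf.isLocallyInjective_iff_injective]
  exact Presheaf.isLocallyInjective_of_isLocallyInjective_of_isLocallySurjective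
    _ (toSheafify (Opens.grothendieckTopology X) F) φ.hom

/-- A section that is locally in the image of an injective homomorphism of sheaves is in its
image. -/
lemma exists_preimage_of_locally {F G : ModuleSheaf R X} (φ : F ⟶ G)
    (hφ : ∀ V, Function.Injective (φ.hom.app V)) (V : Opens X) (s : G.obj.obj (op V))
    (h : ∀ x ∈ V, ∃ (W : Opens X) (i : W ⟶ V), x ∈ W ∧
      ∃ t, φ.hom.app (op W) t = G.obj.map i.op s) :
    ∃ t, φ.hom.app (op V) t = s := by
  have hF : Presieve.IsSheaf (Opens.grothendieckTopology X) (F.obj ⋙ forget _) :=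
    (isSheaf_iff_isSheaf_of_type _ _).1 ((sheafCompose _ (forget (ModuleCat.{u} R))).obj F).2
  have hS : Presheaf.imageSieve φ.hom s ∈ Opens.grothendieckTopology X V := fun x hx => by
    obtain ⟨W, i, hxW, ht⟩ := h x hx
    exact ⟨W, i, ht, hxW⟩
  let fam : Presieve.FamilyOfElements (F.obj ⋙ forget _) (Presheaf.imageSieve φ.hom s).arrows :=
    fun W i hi => Presheaf.localPreimage φ.hom (U := op V) s i hi
  have hfam : ∀ {W : Opens X} (i : W ⟶ V) (hi : Presheaf.imageSieve φ.hom s i),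
      φ.hom.app (op W) (fam i hi) = G.obj.map i.op s := fun i hi =>
    Presheaf.app_localPreimage φ.hom (U := op V) s i hi
  -- Injectivity of `φ` makes the local preimages agree on overlaps.
  have hcompat : fam.Compatible := by
    intro Y₁ Y₂ W g₁ g₂ f₁ f₂ h₁ h₂ hcomp
    apply hφ
    refine (NatTrans.naturality_apply φ.hom g₁.op _).trans
      (Eq.trans ?_ (NatTrans.naturality_apply φ.hom g₂.op _).symm)
    rw [hfam, hfam, ← ConcreteCategory.comp_apply, ← ConcreteCategory.comp_apply,
      ← Functor.map_comp, ← Functor.map_comp, ← op_comp, ← op_comp, hcomp]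
  obtain ⟨t, ht, -⟩ := hF _ hS fam hcompat
  refine ⟨t, sub_eq_zero.1 (eq_zero_of_locally_eq_zero G V _ fun x hx => ?_)⟩
  obtain ⟨W, i, hxW, hi⟩ := h x hx
  refine ⟨W, i, hxW, ?_⟩
  rw [map_sub, sub_eq_zero, ← hfam i hi]
  exact (NatTrans.naturality_apply φ.hom i.op _).symm.trans (congr_arg _ (ht i hi))

lemma tensor_quotient_hom_ext {I : Ideal R} {M G : ModuleSheaf R X}
    {φ ψ : tensor (R ⧸ I) M ⟶ G}
    (h : ∀ V s, φ.hom.app (op V) (toTensorSections (R ⧸ I) M V s) =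
      ψ.hom.app (op V) (toTensorSections (R ⧸ I) M V s)) : φ = ψ := by
  apply Sheaf.hom_ext
  apply sheafify_hom_ext _ _ _ G.2
  refine NatTrans.ext (funext fun V => ModuleCat.hom_ext (LinearMap.ext
    fun (t : (R ⧸ I) ⊗[R] M.obj.obj V) => ?_))
  obtain ⟨s, rfl⟩ := TensorProduct.mk_surjective R _ (R ⧸ I) Ideal.Quotient.mk_surjective t
  exact h V.unop s

end LocalSections

/-! ### The sheaf `I 𝓜` as a kernel. -/

section IdealMul
variable {R : Type u} [CommRing R] {X : TopCat.{u}}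

lemma one_tmul_eq_zero_iff (I : Ideal R) (N : Type*) [AddCommGroup N] [Module R N] (y : N) :
    (1 : R ⧸ I) ⊗ₜ[R] y = 0 ↔ y ∈ I • (⊤ : Submodule R N) := by
  rw [← (TensorProduct.quotTensorEquivQuotSMul N I).map_eq_zero_iff,
    TensorProduct.quotTensorEquivQuotSMul_mk_one_tmul, Submodule.Quotient.mk_eq_zero]

/-- The inclusion of presheaves `I Γ(V, 𝓜) → Γ(V, 𝓜)`. -/
def idealMulPresheafι (I : Ideal R) (M : ModuleSheaf R X) : idealMulPresheaf I M ⟶ M.obj where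
  app _ := ModuleCat.ofHom (Submodule.subtype _)

/-- The inclusion of sheaves `I 𝓜 → 𝓜`. -/
def idealMulι (I : Ideal R) (M : ModuleSheaf R X) : idealMul I M ⟶ M :=
  ⟨sheafifyLift _ (idealMulPresheafι I M) M.2⟩

lemma idealMulι_idealMulSections (I : Ideal R) (M : ModuleSheaf R X) (V : Opens X)
    (s : (I • ⊤ : Submodule R (M.obj.obj (op V)))) :
    (idealMulι I M).hom.app (op V) (idealMulSections I M V s) = s :=
  congr_arg (fun φ => φ.app (op V) s)
    (toSheafify_sheafifyLift (Opens.grothendieckTopology X) (idealMulPresheafι I M) M.2)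

lemma idealMulι_injective (I : Ideal R) (M : ModuleSheaf R X) (V : (Opens X)ᵒᵖ) :
    Function.Injective ((idealMulι I M).hom.app V) := by
  refine injective_of_locally_injective_toSheafify _ _ _ ?_ V
  refine Presheaf.isLocallyInjective_of_injective _ _ fun W s t hst => Subtype.ext ?_
  exact (idealMulι_idealMulSections I M W.unop s).symm.trans
    (Eq.trans hst (idealMulι_idealMulSections I M W.unop t))

lemma exists_local_idealMulSections (I : Ideal R) (M : ModuleSheaf R X) (V : Opens X)
    (t : (idealMul I M).obj.obj (op V)) (x : X) (hx : x ∈ V) :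
    ∃ (W : Opens X) (i : W ⟶ V) (t' : (I • ⊤ : Submodule R (M.obj.obj (op W)))), x ∈ W ∧
      idealMulSections I M W t' = (idealMul I M).obj.map i.op t ∧
      M.obj.map i.op ((idealMulι I M).hom.app (op V) t) = t' := by
  obtain ⟨W, i, t', hxW, ht'⟩ := exists_local_preimage _ V t x hx
  refine ⟨W, i, t', hxW, ht', ?_⟩
  refine Eq.trans ?_ (idealMulι_idealMulSections I M W t')
  refine (NatTrans.naturality_apply (idealMulι I M).hom i.op t).symm.trans ?_
  exact congr_arg _ ht'.symm

/-- The sheaf `I 𝓜` is the kernel of `𝓜 → R / I ⊗ 𝓜`. -/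
lemma toTensorSections_eq_zero_iff (I : Ideal R) (M : ModuleSheaf R X) (V : Opens X)
    (s : M.obj.obj (op V)) :
    toTensorSections (R ⧸ I) M V s = 0 ↔ ∃ t, (idealMulι I M).hom.app (op V) t = s := by
  constructor
  · intro h
    refine exists_preimage_of_locally _ (idealMulι_injective I M) V s fun x hx => ?_
    obtain ⟨W, i, hxW, hW⟩ := locally_eq_zero_of_toSheafify_eq_zero _ V _ h x hx
    have hW' : (1 : R ⧸ I) ⊗ₜ[R] (M.obj.map i.op s) = 0 := hW
    rw [one_tmul_eq_zero_iff] at hW'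
    exact ⟨W, i, hxW, _, idealMulι_idealMulSections I M W ⟨_, hW'⟩⟩
  · rintro ⟨t, rfl⟩
    refine eq_zero_of_locally_eq_zero _ V _ fun x hx => ?_
    obtain ⟨W, i, t', hxW, -, h1⟩ := exists_local_idealMulSections I M V t x hx
    refine ⟨W, i, hxW, ?_⟩
    refine (NatTrans.naturality_apply (toTensor (R ⧸ I) M).hom i.op _).symm.trans ?_
    rw [h1]
    refine (congr_arg (tensorSections (R ⧸ I) M W)
      ((one_tmul_eq_zero_iff I _ _).2 t'.2)).trans (map_zero _)

end IdealMul

/-! ### Completeness of the sheaf `I ^ i 𝓜`. -/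

section IdealMulComplete
variable {R : Type u} [CommRing R] {X : TopCat.{u}}

/-- The projection `R / I → R / J` for `I ≤ J`. -/
abbrev quotientFactor {I J : Ideal R} (h : I ≤ J) : (R ⧸ I) →ₗ[R] (R ⧸ J) :=
  (Ideal.Quotient.factorₐ R h).toLinearMap

lemma quotientFactor_toTensorSections {I J : Ideal R} (h : I ≤ J) (M : ModuleSheaf R X)
    (V : Opens X) (s : M.obj.obj (op V)) :
    tensorMapSections (quotientFactor h) M V (toTensorSections (R ⧸ I) M V s) =
      toTensorSections (R ⧸ J) M V s :=
  tensorMapSections_tensorSections _ _ _ _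

variable {I J L : Ideal R} (M : ModuleSheaf R X)

lemma toTensorSections_idealMulι_smul (hL : J * I = L) (V : Opens X) (a : R) (ha : a ∈ J)
    (s : (idealMul I M).obj.obj (op V)) :
    toTensorSections (R ⧸ L) M V ((idealMulι I M).hom.app (op V) (a • s)) = 0 := by
  refine eq_zero_of_locally_eq_zero _ V _ fun x hx => ?_
  obtain ⟨W, i, t, hxW, -, ht⟩ := exists_local_idealMulSections I M V s x hx
  refine ⟨W, i, hxW, ?_⟩
  refine (NatTrans.naturality_apply (toTensor (R ⧸ L) M).hom i.op _).symm.trans ?_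
  rw [map_smul, map_smul, ht]
  refine (congr_arg (tensorSections (R ⧸ L) M W) ((one_tmul_eq_zero_iff L _ _).2 ?_)).trans
    (map_zero _)
  rw [← hL, mul_smul]
  exact Submodule.smul_mem_smul ha t.2

variable (hL : J * I = L)

/-- The homomorphism `R / J ⊗ Γ(V, I 𝓜) → Γ(V, R / (J I) ⊗ 𝓜)`. -/
def quotientTensorIdealMulSections (V : Opens X) :
    (R ⧸ J) ⊗[R] ((idealMul I M).obj.obj (op V)) →ₗ[R] (tensor (R ⧸ L) M).obj.obj (op V) :=
  (Submodule.liftQ (J • ⊤) (toTensorSections (R ⧸ L) M V ∘ₗ ((idealMulι I M).hom.app (op V)).hom)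
    (by
    rw [Submodule.smul_le]
    intro a ha s _
    exact toTensorSections_idealMulι_smul M hL V a ha s)) ∘ₗ
  (TensorProduct.quotTensorEquivQuotSMul _ J).toLinearMap

lemma quotientTensorIdealMulSections_one_tmul (V : Opens X) (s : (idealMul I M).obj.obj (op V)) :
    quotientTensorIdealMulSections M hL V (1 ⊗ₜ s) =
      toTensorSections (R ⧸ L) M V ((idealMulι I M).hom.app (op V) s) := by
  rw [quotientTensorIdealMulSections, LinearMap.comp_apply, LinearEquiv.coe_coe,
    TensorProduct.quotTensorEquivQuotSMul_mk_one_tmul]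
  rfl

/-- The presheaf homomorphism `R / J ⊗ Γ(V, I 𝓜) → Γ(V, R / (J I) ⊗ 𝓜)`. -/
def quotientTensorIdealMulPresheaf : tensorPresheaf (R ⧸ J) (idealMul I M) ⟶
    (tensor (R ⧸ L) M).obj where
  app V := ModuleCat.ofHom (quotientTensorIdealMulSections M hL V.unop)
  naturality V W f := by
    refine ModuleCat.hom_ext (LinearMap.ext fun (t : (R ⧸ J) ⊗[R] (idealMul I M).obj.obj V) => ?_)
    obtain ⟨s, rfl⟩ := TensorProduct.mk_surjective R _ (R ⧸ J) Ideal.Quotient.mk_surjective t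
    refine (quotientTensorIdealMulSections_one_tmul M hL W.unop
      ((idealMul I M).obj.map f s)).trans ?_
    refine Eq.trans ?_ (congr_arg ((tensor (R ⧸ L) M).obj.map f)
      (quotientTensorIdealMulSections_one_tmul M hL V.unop s)).symm
    exact (congr_arg _ (NatTrans.naturality_apply (idealMulι I M).hom f s)).trans
      (NatTrans.naturality_apply (toTensor (R ⧸ L) M).hom f _)

/-- The canonical homomorphism `R / J ⊗ I 𝓜 → R / (J I) ⊗ 𝓜`. -/
def quotientTensorIdealMul : tensor (R ⧸ J) (idealMul I M) ⟶ tensor (R ⧸ L) M :=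
  ⟨sheafifyLift _ (quotientTensorIdealMulPresheaf M hL) (tensor (R ⧸ L) M).2⟩

lemma quotientTensorIdealMul_toTensorSections (V : Opens X) (s : (idealMul I M).obj.obj (op V)) :
    (quotientTensorIdealMul M hL).hom.app (op V) (toTensorSections (R ⧸ J) (idealMul I M) V s) =
      toTensorSections (R ⧸ L) M V ((idealMulι I M).hom.app (op V) s) := by
  refine Eq.trans ?_ (quotientTensorIdealMulSections_one_tmul M hL V s)
  exact congr_arg (fun φ => φ.app (op V) (1 ⊗ₜ s))
    (toSheafify_sheafifyLift (Opens.grothendieckTopology X) (quotientTensorIdealMulPresheaf M hL)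
      (tensor (R ⧸ L) M).2)

/-- After shrinking, a section in the kernel comes from an element of `I Γ` that lies in `L Γ = J (I
Γ)`; its image is then divisible by `J` in `I 𝓜`, so it dies in `R / J ⊗ I 𝓜`. -/
lemma quotientTensorIdealMul_injective (V : (Opens X)ᵒᵖ) :
    Function.Injective ((quotientTensorIdealMul M hL).hom.app V) := by
  refine injective_of_locally_injective_toSheafify _ _ _ ?_ V
  refine isLocallyInjective_of_locally_eq_zero _ fun V
    (t : (R ⧸ J) ⊗[R] (idealMul I M).obj.obj (op V))
    ht x hx => ?_
  obtain ⟨s, rfl⟩ := TensorProduct.mk_surjective R _ (R ⧸ J) Ideal.Quotient.mk_surjective t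
  replace ht : toTensorSections (R ⧸ L) M V ((idealMulι I M).hom.app (op V) s) = 0 :=
    (quotientTensorIdealMul_toTensorSections M hL V s).symm.trans ht
  obtain ⟨W, i, s', hxW, hs', hιs⟩ := exists_local_idealMulSections I M V s x hx
  have hW : toTensorSections (R ⧸ L) M W s'.1 = 0 := by
    rw [← hιs]
    refine (NatTrans.naturality_apply (toTensor (R ⧸ L) M).hom i.op _).trans ?_
    exact (congr_arg _ ht).trans (map_zero _)
  obtain ⟨W', i', hxW', hW'⟩ := locally_eq_zero_of_toSheafify_eq_zero _ W _ hW x hxW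
  refine ⟨W', i' ≫ i, hxW', ?_⟩
  have h1 : M.obj.map i'.op s'.1 ∈ L • (⊤ : Submodule R (M.obj.obj (op W'))) :=
    (one_tmul_eq_zero_iff L _ _).1 hW'
  let s'' : (I • ⊤ : Submodule R (M.obj.obj (op W'))) := (idealMulPresheaf I M).map i'.op s'
  have h2 : s'' ∈ J • (⊤ : Submodule R (I • ⊤ : Submodule R (M.obj.obj (op W')))) := by
    rw [Submodule.mem_smul_top_iff, ← mul_smul, hL]
    exact h1
  have h3 : (idealMul I M).obj.map (i' ≫ i).op s = idealMulSections I M W' s'' := by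
    rw [op_comp, Functor.map_comp, ConcreteCategory.comp_apply, ← hs']
    exact (NatTrans.naturality_apply (toSheafify (Opens.grothendieckTopology X)
      (idealMulPresheaf I M)) i'.op s').symm
  have h4 : (idealMul I M).obj.map (i' ≫ i).op s ∈ J •
    (⊤ : Submodule R ((idealMul I M).obj.obj (op W'))) := by
    rw [h3]
    have := Submodule.mem_map_of_mem (f := idealMulSections I M W') h2
    rw [Submodule.map_smul''] at this
    exact Submodule.smul_mono le_rfl le_top this
  exact (one_tmul_eq_zero_iff J _ _).2 h4

lemma quotientFactor_quotientTensorIdealMul (h : L ≤ I) (V : Opens X)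
    (t : (tensor (R ⧸ J) (idealMul I M)).obj.obj (op V)) :
    tensorMapSections (quotientFactor h) M V ((quotientTensorIdealMul M hL).hom.app (op V) t) =
      0 := by
  have : quotientTensorIdealMul M hL ≫ tensorMap (quotientFactor h) M = 0 := by
    refine tensor_quotient_hom_ext fun V s => ?_
    refine (congr_arg (tensorMapSections (quotientFactor h) M V)
      (quotientTensorIdealMul_toTensorSections M hL V s)).trans ?_
    refine (quotientFactor_toTensorSections h M V _).trans ?_
    exact (toTensorSections_eq_zero_iff _ M V _).2 ⟨s, rfl⟩
  exact congr_arg (fun φ => φ.hom.app (op V) t) this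

/-- A compatible family for `I ^ i 𝓜` embeds into one for `𝓜` and so comes from a section `s`. This
`s` dies in `R / I ^ i ⊗ 𝓜`, hence lies in `I ^ i 𝓜`, and injectivity of the embeddings recovers the
family. -/
lemma idealMul_isSheafAdicComplete (I : Ideal R) (hM : IsSheafAdicComplete I M) (i : ℕ) :
    IsSheafAdicComplete I (idealMul (I ^ i) M) := by
  have hL : ∀ j, I ^ (j + 1) * I ^ i = I ^ (i + j + 1) := fun j => by
    rw [← pow_add]
    congr 1
    omega
  let q := fun j => quotientTensorIdealMul M (hL j)
  have hq : ∀ (j : ℕ) (V : Opens X) (s : (idealMul (I ^ i) M).obj.obj (op V)),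
      (q j).hom.app (op V) (toTensorSections _ _ V s) =
        toTensorSections (R ⧸ I ^ (i + j + 1)) M V ((idealMulι (I ^ i) M).hom.app (op V) s) :=
    fun j => quotientTensorIdealMul_toTensorSections M (hL j)
  have hq' : ∀ (k l : ℕ) (h : k ≤ l) (V : Opens X)
      (t : (tensor (R ⧸ I ^ (l + 1)) (idealMul (I ^ i) M)).obj.obj (op V)),
      tensorMapSections (powTransition I (Nat.add_le_add_left h i)) M V ((q l).hom.app (op V) t) =
        (q k).hom.app (op V) (tensorMapSections (powTransition I h) _ V t) := by
    intro k l h V t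
    have : q l ≫ tensorMap (powTransition I (Nat.add_le_add_left h i)) M =
        tensorMap (powTransition I h) _ ≫ q k := by
      refine tensor_quotient_hom_ext fun V s => ?_
      refine (congr_arg (tensorMapSections (powTransition I (Nat.add_le_add_left h i)) M V)
        (hq l V s)).trans ?_
      refine (powTransition_toTensorSections I _ M V _).trans ?_
      refine (hq k V s).symm.trans ?_
      exact congr_arg _ (powTransition_toTensorSections I h _ V _).symm
    exact congr_arg (fun φ => φ.hom.app (op V) t) this
  rw [isSheafAdicComplete_iff] at hM ⊢
  refine fun V => ⟨fun s hs => ?_, fun t ht => ?_⟩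
  · apply idealMulι_injective
    rw [map_zero]
    refine (hM V).1 _ fun k => ?_
    rw [← powTransition_toTensorSections I (Nat.le_add_left k i), ← hq k, hs k, map_zero, map_zero]
  -- The embedding `q k` lands at exponent `i + k + 1`; projecting down to `k + 1` gives a family
  -- indexed like the system of `𝓜`.
  · obtain ⟨s, hs⟩ := (hM V).2 (fun k => tensorMapSections
      (powTransition I (Nat.le_add_left k i)) M V ((q k).hom.app (op V) (t k))) (fun k l h => by
        rw [powTransition_powTransition, ← ht k l h, ← hq' k l h V, powTransition_powTransition])
    have hs' : ∀ j, toTensorSections (R ⧸ I ^ (i + j + 1)) M V s = (q j).hom.app (op V) (t j) :=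
      fun j => by
        refine (hs (i + j)).trans ((hq' j (i + j) (Nat.le_add_left j i) V _).trans ?_)
        exact congr_arg _ (ht j (i + j) (Nat.le_add_left j i))
    have h0 : toTensorSections (R ⧸ I ^ i) M V s = 0 := by
      have hle : I ^ (i + 0 + 1) ≤ I ^ i := Ideal.pow_le_pow_right (by omega)
      rw [← quotientFactor_toTensorSections hle, hs' 0]
      exact quotientFactor_quotientTensorIdealMul M (hL 0) hle V (t 0)
    obtain ⟨s', rfl⟩ := (toTensorSections_eq_zero_iff _ M V s).1 h0
    refine ⟨s', fun j => quotientTensorIdealMul_injective M (hL j) (op V) ?_⟩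
    exact (hq j V s').trans (hs' j)

end IdealMulComplete

/-! ### Dévissage for `P ⊗ Γ(U, 𝓜) → Γ(U, P ⊗ 𝓜)`. -/

section BaseChange
variable {R : Type u} [CommRing R] {X : TopCat.{u}}

section Exact
variable {P Q S : Type u} [AddCommGroup P] [Module R P] [AddCommGroup Q] [Module R Q]
  [AddCommGroup S] [Module R S] {f : P →ₗ[R] Q} {g : Q →ₗ[R] S} {M : ModuleSheaf R X} {U : Opens X}

/-- A four-lemma chase from the right exact row of tensor products to the left exact row of
sections; no surjectivity onto the sections of `S ⊗ 𝓜` is needed. -/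
lemma tensorSections_surjective_of_exact (hf : Function.Injective f) (hfg : Function.Exact f g)
    (hg : Function.Surjective g) (hM : IsSheafFlat M)
    (hP : Function.Surjective (tensorSections P M U))
    (hS : Function.Surjective (tensorSections S M U)) :
    Function.Surjective (tensorSections Q M U) := by
  intro t
  obtain ⟨s, hs⟩ := hS (tensorMapSections g M U t)
  obtain ⟨q, rfl⟩ := LinearMap.rTensor_surjective _ hg s
  rw [← tensorMapSections_tensorSections, ← sub_eq_zero, ← map_sub] at hs
  obtain ⟨t', ht'⟩ := (tensorMap_exact f g hf hfg hg M hM (op U) _).1 hs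
  obtain ⟨p, rfl⟩ := hP t'
  refine ⟨q - f.rTensor _ p, ?_⟩
  rw [map_sub, ← tensorMapSections_tensorSections]
  exact (congr_arg _ ht').trans (sub_sub_cancel _ _)

lemma tensorSections_injective_of_exact (hf : Function.Injective f) (hfg : Function.Exact f g)
    (hg : Function.Surjective g) (hM : IsSheafFlat M)
    (hP : Function.Injective (tensorSections P M U))
    (hS : Function.Injective (tensorSections S M U)) :
    Function.Injective (tensorSections Q M U) := by
  refine (injective_iff_map_eq_zero _).2 fun t ht => ?_
  have h1 : g.rTensor _ t = 0 := hS (by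
    rw [← tensorMapSections_tensorSections, ht, map_zero, map_zero])
  obtain ⟨p, rfl⟩ := (rTensor_exact _ hfg hg t).1 h1
  have h2 : p = 0 := hP (tensorMap_injective f hf M hM (op U) (by
    refine (tensorMapSections_tensorSections f M U p).trans (ht.trans ?_)
    rw [map_zero]
    exact (map_zero _).symm))
  rw [h2, map_zero]

end Exact

lemma tensorSections_surjective_of_equiv {P Q : Type u} [AddCommGroup P] [Module R P]
    [AddCommGroup Q] [Module R Q] (e : P ≃ₗ[R] Q) {M : ModuleSheaf R X} {U : Opens X}
    (h : Function.Surjective (tensorSections P M U)) :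
    Function.Surjective (tensorSections Q M U) := by
  intro t
  obtain ⟨p, hp⟩ := h (tensorMapSections e.symm.toLinearMap M U t)
  refine ⟨e.toLinearMap.rTensor _ p, ?_⟩
  rw [← tensorMapSections_tensorSections, hp, ← tensorMapSections_comp, e.comp_symm]
  exact congr_arg (fun φ => φ.hom.app (op U) t) (tensorMap_id Q M)

lemma tensorSections_injective_of_equiv {P Q : Type u} [AddCommGroup P] [Module R P]
    [AddCommGroup Q] [Module R Q] (e : P ≃ₗ[R] Q) {M : ModuleSheaf R X} {U : Opens X}
    (h : Function.Injective (tensorSections P M U)) :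
    Function.Injective (tensorSections Q M U) := by
  refine (injective_iff_map_eq_zero _).2 fun t ht => ?_
  have h1 : e.symm.toLinearMap.rTensor _ t = 0 := h (by
    rw [← tensorMapSections_tensorSections, ht, map_zero, map_zero])
  exact (e.symm.rTensor (M.obj.obj (op U))).map_eq_zero_iff.1 h1

variable [IsLocalRing R] {M : ModuleSheaf R X} {U : Opens X}

open IsLocalRing

lemma tensorSections_surjective_of_isFiniteLength (hM : IsSheafFlat M)
    (h : Function.Surjective (tensorSections (R ⧸ maximalIdeal R) M U)) (P : Type u)
    [AddCommGroup P] [Module R P] (hP : IsFiniteLength R P) :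
    Function.Surjective (tensorSections P M U) := by
  induction hP with
  | of_subsingleton =>
    have := tensor_subsingleton (R := R) ‹_› M (op U)
    exact fun t => ⟨0, Subsingleton.elim _ _⟩
  | @of_simple_quotient P _ _ N _ _ ih =>
    refine tensorSections_surjective_of_exact N.subtype_injective
      (LinearMap.exact_subtype_mkQ N) N.mkQ_surjective hM ih ?_
    obtain ⟨I, hI, ⟨e⟩⟩ := isSimpleModule_iff_quot_maximal.1
      (inferInstance : IsSimpleModule R (P ⧸ N))
    obtain rfl := eq_maximalIdeal hI
    exact tensorSections_surjective_of_equiv e.symm h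

lemma tensorSections_injective_of_isFiniteLength (hM : IsSheafFlat M)
    (h : Function.Injective (tensorSections (R ⧸ maximalIdeal R) M U)) (P : Type u)
    [AddCommGroup P] [Module R P] (hP : IsFiniteLength R P) :
    Function.Injective (tensorSections P M U) := by
  induction hP with
  | of_subsingleton => exact Function.injective_of_subsingleton _
  | @of_simple_quotient P _ _ N _ _ ih =>
    refine tensorSections_injective_of_exact N.subtype_injective
      (LinearMap.exact_subtype_mkQ N) N.mkQ_surjective hM ih ?_
    obtain ⟨I, hI, ⟨e⟩⟩ := isSimpleModule_iff_quot_maximal.1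
      (inferInstance : IsSimpleModule R (P ⧸ N))
    obtain rfl := eq_maximalIdeal hI
    exact tensorSections_injective_of_equiv e.symm h

end BaseChange

/-! ### The kernel filtration on sections. -/

section Complete
variable {R : Type u} [CommRing R] {X : TopCat.{u}} {M : ModuleSheaf R X} {U : Opens X}

lemma exists_rTensor_gradedPiece_eq (I : Ideal R) (k : ℕ) (N : Type*) [AddCommGroup N] [Module R N]
    (τ : gradedPiece I k ⊗[R] N) : ∃ y ∈ I ^ k • (⊤ : Submodule R N),
      (gradedPiece I k).subtype.rTensor N τ = 1 ⊗ₜ y := by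
  induction τ with
  | zero => exact ⟨0, zero_mem _, by simp⟩
  | add a b ha hb =>
    obtain ⟨y, hy, ha⟩ := ha
    obtain ⟨z, hz, hb⟩ := hb
    exact ⟨y + z, add_mem hy hz, by rw [map_add, ha, hb, TensorProduct.tmul_add]⟩
  | tmul a x =>
    obtain ⟨_, ⟨r, hr, rfl⟩⟩ := a
    refine ⟨r • x, Submodule.smul_mem_smul hr trivial, ?_⟩
    rw [LinearMap.rTensor_tmul, TensorProduct.tmul_smul, TensorProduct.smul_tmul']
    congr 1
    change Ideal.Quotient.mk _ r = r • Ideal.Quotient.mk _ 1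
    exact (congr_arg (Ideal.Quotient.mk _) (mul_one r)).symm

/-- The kernel of `Γ(U, 𝓜) → Γ(U, R / I ^ n ⊗ 𝓜)`. -/
def sectionsFiltration (I : Ideal R) (M : ModuleSheaf R X) (U : Opens X) (n : ℕ) :
    Submodule R (M.obj.obj (op U)) :=
  LinearMap.ker (toTensorSections (R ⧸ I ^ n) M U)

lemma sectionsFiltration_antitone (I : Ideal R) (M : ModuleSheaf R X) (U : Opens X) :
    Antitone (sectionsFiltration I M U) := fun m n h s hs => by
  have := congr_arg (tensorMapSections (quotientFactor (Ideal.pow_le_pow_right h)) M U)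
    (LinearMap.mem_ker.1 hs)
  rw [quotientFactor_toTensorSections, map_zero] at this
  exact this

lemma pow_smul_top_le_sectionsFiltration (I : Ideal R) (M : ModuleSheaf R X) (U : Opens X) (n : ℕ) :
    I ^ n • ⊤ ≤ sectionsFiltration I M U n := fun s hs => by
  rw [sectionsFiltration, LinearMap.mem_ker, toTensorSections_eq, (one_tmul_eq_zero_iff _ _ _).2 hs,
    map_zero]

lemma exact_gradedPiece (I : Ideal R) (k : ℕ) :
    Function.Exact (gradedPiece I k).subtype
      (quotientFactor (I := I ^ (k + 1)) (J := I ^ k) (Ideal.pow_le_pow_right k.le_succ)) := by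
  intro x
  obtain ⟨r, rfl⟩ := Ideal.Quotient.mk_surjective x
  constructor
  · intro h
    have : r ∈ I ^ k := Ideal.Quotient.eq_zero_iff_mem.1 h
    exact ⟨⟨_, r, this, rfl⟩, rfl⟩
  · rintro ⟨⟨_, ⟨s, hs, rfl⟩⟩, h⟩
    rw [← h]
    exact Ideal.Quotient.eq_zero_iff_mem.2 hs

/-- An element of level `k` maps into the sections of `I^k/I^(k+1) ⊗ 𝓜`. By `h` this image comes
from a tensor, hence from some `y ∈ I ^ k Γ`, and subtracting `y` reaches level `k + 1`. -/
lemma sectionsFiltration_le_sup (I : Ideal R) (hM : IsSheafFlat M) (k : ℕ)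
    (h : Function.Surjective (tensorSections (gradedPiece I k) M U)) :
    sectionsFiltration I M U k ≤ I ^ k • ⊤ ⊔ sectionsFiltration I M U (k + 1) := by
  intro s hs
  have h0 : tensorMapSections (quotientFactor (I := I ^ (k + 1)) (J := I ^ k)
      (Ideal.pow_le_pow_right k.le_succ)) M U (toTensorSections (R ⧸ I ^ (k + 1)) M U s) = 0 := by
    rw [quotientFactor_toTensorSections]
    exact hs
  obtain ⟨t, ht⟩ := (tensorMap_exact (gradedPiece I k).subtype _ (Submodule.subtype_injective _)
    (exact_gradedPiece I k)
    (Ideal.Quotient.factor_surjective (Ideal.pow_le_pow_right k.le_succ)) M hM (op U) _).1 h0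
  obtain ⟨τ, rfl⟩ := h t
  obtain ⟨y, hy, hτ⟩ := exists_rTensor_gradedPiece_eq I k _ τ
  refine Submodule.mem_sup.2 ⟨y, hy, s - y, ?_, by abel⟩
  rw [sectionsFiltration, LinearMap.mem_ker, map_sub, sub_eq_zero, ← ht]
  refine (tensorMapSections_tensorSections _ M U τ).trans ?_
  rw [hτ]
  rfl

lemma sectionsFiltration_separated {I : Ideal R} (hc : IsSheafAdicComplete I M)
    (s : M.obj.obj (op U)) (hs : ∀ n, s ∈ sectionsFiltration I M U n) : s = 0 :=
  ((isSheafAdicComplete_iff I M).1 hc U).1 s fun i => hs (i + 1)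

lemma sectionsFiltration_complete {I : Ideal R} (hc : IsSheafAdicComplete I M)
    (x : ℕ → M.obj.obj (op U)) (hx : ∀ n, x (n + 1) - x n ∈ sectionsFiltration I M U n) :
    ∃ y, ∀ n, y - x n ∈ sectionsFiltration I M U n := by
  have hanti := sectionsFiltration_antitone I M U
  have hx' : ∀ m n, m ≤ n → x n - x m ∈ sectionsFiltration I M U m := fun m n h => by
    induction n, h using Nat.le_induction with
    | base => simp
    | succ n h ih => simpa using add_mem (hanti h (hx n)) ih
  -- The adic system starts at `R / I`, so index `i` uses the term `x (i + 1)`.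
  obtain ⟨y, hy⟩ := ((isSheafAdicComplete_iff I M).1 hc U).2
    (fun i => toTensorSections (R ⧸ I ^ (i + 1)) M U (x (i + 1))) (fun i j h => by
      rw [powTransition_toTensorSections, ← sub_eq_zero, ← map_sub]
      exact hx' (i + 1) (j + 1) (Nat.succ_le_succ h))
  have hy' : ∀ n, y - x (n + 1) ∈ sectionsFiltration I M U (n + 1) := fun n => by
    rw [sectionsFiltration, LinearMap.mem_ker, map_sub, sub_eq_zero]
    exact hy n
  refine ⟨y, fun n => ?_⟩
  simpa using add_mem (hanti n.le_succ (hy' n)) (hx n)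

/-- If the transition maps are surjective on sections, then so is the map from the limit. -/
lemma toTensorSections_surjective {I : Ideal R} (hc : IsSheafAdicComplete I M)
    (h : ∀ i : ℕ, Function.Surjective (tensorMapSections (powTransition I i.le_succ) M U)) :
    Function.Surjective (toTensorSections (R ⧸ I ^ (0 + 1)) M U) := by
  intro t₀
  choose lift hlift using h
  let t : ∀ i, (tensor (R ⧸ I ^ (i + 1)) M).obj.obj (op U) := fun i =>
    Nat.rec (motive := fun i => (tensor (R ⧸ I ^ (i + 1)) M).obj.obj (op U)) t₀ lift i
  have ht : ∀ i j (hij : i ≤ j), tensorMapSections (powTransition I hij) M U (t j) = t i := by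
    intro i j hij
    induction j, hij using Nat.le_induction with
    | base =>
      rw [powTransition_refl]
      exact congr_arg (fun φ => φ.hom.app (op U) (t i)) (tensorMap_id _ M)
    | succ j hij ih =>
      rw [← powTransition_powTransition I hij j.le_succ]
      exact (congr_arg _ (hlift j (t j))).trans ih
  obtain ⟨s, hs⟩ := ((isSheafAdicComplete_iff I M).1 hc U).2 t ht
  exact ⟨s, hs 0⟩

end Complete

/-! ### Base change, completeness and flatness of the sections. -/

section Main
variable {R : Type u} [CommRing R] [IsLocalRing R] [IsNoetherianRing R] {X : TopCat.{u}}
  {M : ModuleSheaf R X} {U : Opens X}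

open IsLocalRing

lemma isFiniteLength_gradedPiece (k : ℕ) : IsFiniteLength R (gradedPiece (maximalIdeal R) k) :=
  isFiniteLength_submodule (isFiniteLength_quotient_pow (k + 1)) _

/-- The kernels of the transition maps have finite length, so their `H¹` vanishes and sections lift
through the whole system. This settles `P = R/m`; dévissage gives the rest. -/
lemma tensorSections_surjective (hM : IsSheafFlat M)
    (hc : IsSheafAdicComplete (maximalIdeal R) M) (hU : TensorAcyclic (ResidueField R) M U)
    (P : Type u) [AddCommGroup P] [Module R P] (hP : IsFiniteLength R P) :
    Function.Surjective (tensorSections P M U) := by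
  refine tensorSections_surjective_of_isFiniteLength hM ?_ P hP
  refine tensorSections_surjective_of_equiv
    (Submodule.quotEquivOfEq (maximalIdeal R ^ (0 + 1)) (maximalIdeal R) (by simp)) ?_
  have h := toTensorSections_surjective (U := U) hc fun i =>
    tensorMap_surjective (LinearMap.ker (powTransition (maximalIdeal R) i.le_succ)).subtype
      (powTransition (maximalIdeal R) i.le_succ) (Submodule.subtype_injective _)
      (LinearMap.exact_subtype_ker_map _)
      (Ideal.Quotient.factor_surjective (Ideal.pow_le_pow_right i.succ.le_succ)) M hM U
      (.of_isFiniteLength M hM U hU _ (isFiniteLength_submodule (isFiniteLength_quotient_pow _) _))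
  exact fun t => (h t).imp' (fun s => 1 ⊗ₜ s) fun _ hs => hs

lemma sectionsFiltration_eq (hM : IsSheafFlat M)
    (hc : IsSheafAdicComplete (maximalIdeal R) M) (hU : TensorAcyclic (ResidueField R) M U)
    (k : ℕ) : sectionsFiltration (maximalIdeal R) M U k = maximalIdeal R ^ k • ⊤ :=
  le_antisymm (filtration_le_pow_smul_top _ (IsNoetherian.noetherian _) _
    (sectionsFiltration_antitone _ M U) (pow_smul_top_le_sectionsFiltration _ M U)
    (fun k => sectionsFiltration_le_sup _ hM k
      (tensorSections_surjective hM hc hU _ (isFiniteLength_gradedPiece k)))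
    (sectionsFiltration_separated hc) (sectionsFiltration_complete hc) k)
    (pow_smul_top_le_sectionsFiltration _ M U k)

lemma sections_isAdicComplete (hM : IsSheafFlat M)
    (hc : IsSheafAdicComplete (maximalIdeal R) M) (hU : TensorAcyclic (ResidueField R) M U) :
    IsAdicComplete (maximalIdeal R) (M.obj.obj (op U)) :=
  isAdicComplete_of_filtration _ _ (sectionsFiltration_eq hM hc hU)
    (sectionsFiltration_separated hc) (sectionsFiltration_complete hc)

/-- Injectivity for `P = R/m` says that the first filtration step is `m Γ`; dévissage extends it. -/
lemma tensorSections_bijective (hM : IsSheafFlat M)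
    (hc : IsSheafAdicComplete (maximalIdeal R) M) (hU : TensorAcyclic (ResidueField R) M U)
    (P : Type u) [AddCommGroup P] [Module R P] (hP : IsFiniteLength R P) :
    Function.Bijective (tensorSections P M U) := by
  refine ⟨tensorSections_injective_of_isFiniteLength hM ?_ P hP,
    tensorSections_surjective hM hc hU P hP⟩
  refine tensorSections_injective_of_equiv
    (Submodule.quotEquivOfEq (maximalIdeal R ^ 1) (maximalIdeal R) (by simp)) ?_
  refine (injective_iff_map_eq_zero _).2 fun t ht => ?_
  obtain ⟨s, rfl⟩ := TensorProduct.mk_surjective R _ _ Ideal.Quotient.mk_surjective t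
  have hs : s ∈ sectionsFiltration (maximalIdeal R) M U 1 := ht
  rw [sectionsFiltration_eq hM hc hU] at hs
  exact (one_tmul_eq_zero_iff _ _ _).2 hs

/-- Injectivity on graded pieces is inherited from the sheaves, through the base change isomorphism
for `m^k/m^(k+1)`. -/
lemma sections_flat [IsAdicComplete (maximalIdeal R) R] (hM : IsSheafFlat M)
    (hc : IsSheafAdicComplete (maximalIdeal R) M) (hU : TensorAcyclic (ResidueField R) M U) :
    Module.Flat R (M.obj.obj (op U)) := by
  have := sections_isAdicComplete hM hc hU
  refine flat_of_isAdicComplete _ fun k => ?_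
  have h : Function.Injective (tensorSections (R ⧸ maximalIdeal R ^ (k + 1)) M U ∘
      (gradedPiece (maximalIdeal R) k).subtype.rTensor (M.obj.obj (op U))) := by
    have h' : (tensorSections (R ⧸ maximalIdeal R ^ (k + 1)) M U ∘
        (gradedPiece (maximalIdeal R) k).subtype.rTensor (M.obj.obj (op U))) =
        tensorMapSections (gradedPiece (maximalIdeal R) k).subtype M U ∘
          tensorSections (gradedPiece (maximalIdeal R) k) M U :=
      funext fun t => (tensorMapSections_tensorSections _ M U t).symm
    rw [h']
    exact (tensorMap_injective _ (Submodule.subtype_injective _) M hM (op U)).comp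
      (tensorSections_bijective hM hc hU _ (isFiniteLength_gradedPiece k)).1
  exact h.of_comp

lemma idealMulSections_bijective (hM : IsSheafFlat M)
    (hc : IsSheafAdicComplete (maximalIdeal R) M) (hU : TensorAcyclic (ResidueField R) M U)
    (i : ℕ) : Function.Bijective (idealMulSections (maximalIdeal R ^ i) M U) := by
  constructor
  · intro s t hst
    rw [Subtype.ext_iff, ← idealMulι_idealMulSections, ← idealMulι_idealMulSections, hst]
  · intro σ
    have hσ : (idealMulι (maximalIdeal R ^ i) M).hom.app (op U) σ ∈
        sectionsFiltration (maximalIdeal R) M U i :=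
      (toTensorSections_eq_zero_iff _ M U _).2 ⟨σ, rfl⟩
    rw [sectionsFiltration_eq hM hc hU] at hσ
    exact ⟨⟨_, hσ⟩, idealMulι_injective _ M (op U) (idealMulι_idealMulSections _ M U ⟨_, hσ⟩)⟩

end Main

end CompleteSheaf

end

open CompleteSheaf in
theorem theorem0p2 (K : Type v) [Field K] (R : Type u) [CommRing R] [Algebra K R]
    [IsLocalRing R] [IsNoetherianRing R] [IsAdicComplete (IsLocalRing.maximalIdeal R) R]
    (hK : Function.Bijective (algebraMap K (IsLocalRing.ResidueField R)))
    (X : TopCat.{u}) (M : ModuleSheaf R X) (U : Opens X)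
    (hflat : IsSheafFlat M)
    (hcomplete : IsSheafAdicComplete (IsLocalRing.maximalIdeal R) M)
    (henough : HasEnoughAcyclicOpens (toAb (tensor (IsLocalRing.ResidueField R) M)))
    (hU : IsAcyclic (toAb (tensor (IsLocalRing.ResidueField R) M)) U) :
    (Module.Flat R (M.obj.obj (op U)) ∧
      IsAdicComplete (IsLocalRing.maximalIdeal R) (M.obj.obj (op U))) ∧
    ∀ i : ℕ,
      Function.Bijective (tensorSections (R ⧸ IsLocalRing.maximalIdeal R ^ (i + 1)) M U) ∧
      IsAdicComplete (IsLocalRing.maximalIdeal R)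
        (IsLocalRing.maximalIdeal R ^ i • ⊤ : Submodule R (M.obj.obj (op U))) ∧
      IsSheafAdicComplete (IsLocalRing.maximalIdeal R)
        (idealMul (IsLocalRing.maximalIdeal R ^ i) M) ∧
      Function.Bijective (idealMulSections (IsLocalRing.maximalIdeal R ^ i) M U) := by
  have hU₁ : TensorAcyclic (IsLocalRing.ResidueField R) M U := hU 1 one_pos
  have hsections := sections_isAdicComplete hflat hcomplete hU₁
  exact ⟨⟨sections_flat hflat hcomplete hU₁, hsections⟩, fun i =>
    ⟨tensorSections_bijective hflat hcomplete hU₁ _ (isFiniteLength_quotient_pow _),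
      isAdicComplete_pow_smul_top _ i, idealMul_isSheafAdicComplete M _ hcomplete i,
      idealMulSections_bijective hflat hcomplete hU₁ i⟩⟩
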